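/- Let $\Gamma$ be an additive abelian group with a commutative factor $\omega:\Gamma\times\Gamma\to\mathbb C^*$, i.e. $\omega(\alpha,\beta)=\omega(\beta,\alpha)^{-1}$, $\omega(\alpha,\beta+\gamma)=\omega(\alpha,\beta)\,\omega(\alpha,\gamma)$ and $\omega(\alpha+\beta,\gamma)=\omega(\alpha,\gamma)\,\omega(\beta,\gamma)$; in particular $\omega(\alpha,\alpha)=\pm1$. Let $V=\bigoplus_{\alpha\in\Gamma}V_\alpha$ be a finite-dimensional $\Gamma$-graded complex vector space, $\Gamma_R=\{\alpha\in\Gamma\mid V_\alpha\neq0\}$ and $m_\alpha=\dim V_\alpha$. Fix a total order on $\Gamma_R$ that is distinguished, i.e. $\alpha<\beta$ whenever $\omega(\alpha,\alpha)=1$ and $\omega(\beta,\beta)=-1$. Choose a basis $e(\alpha)_1,\dots,e(\alpha)_{m_\alpha}$ of each $V_\alpha$, $\alpha\in\Gamma_R$, and order the resulting basis of $V$ lexicographically: $(\alpha,i)<(\beta,j)$ iff $\alpha<\beta$, or $\alpha=\beta$ and $i<j$. For $a=(\alpha,i)$ write $e_a=e(\alpha)_i$ and $\omega_a=\omega(\alpha,\alpha)$,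 and let $E_{ab}\in\mathrm{End}_{\mathbb C}(V)$ be the matrix units of this basis, $E_{ab}e_c=\delta_{bc}e_a$. Let $\mathfrak{gl}(V)=\mathfrak{gl}(V(\Gamma,\omega))$ be $\mathrm{End}_{\mathbb C}(V)$ with the $\Gamma$-grading $\mathfrak{gl}(V)_\alpha=\{X\mid XV_\beta\subseteq V_{\alpha+\beta}\ \forall\beta\}$ and the bracket $[X,Y]=XY-\omega(\alpha,\beta)YX$ for $X\in\mathfrak{gl}(V)_\alpha$, $Y\in\mathfrak{gl}(V)_\beta$. A $\mathfrak{gl}(V)$-module means a $\Gamma$-graded one: a complex vector space $L=\bigoplus_{\gamma\in\Gamma} L_\gamma$ with a linear action of $\mathfrak{gl}(V)$ such that $\mathfrak{gl}(V)_\alpha L_\gamma\subseteq L_{\alpha+\gamma}$ and $X(Yv)-\omega(\alpha,\beta)Y(Xv)=[X,Y]v$ for all $X\in\mathfrak{gl}(V)_\alpha$, $Y\in\mathfrak{gl}(V)_\beta$, $v\in L$. It is simple if it is nonzero and has no graded submodules other than $0$ and itself. Let $\mathfrak h=\sum_a\mathbb C E_{aa}$ and $\mathfrak n=\sum_{a<b}\mathbb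 C E_{ab}$. For $\lambda\in\mathfrak h^*$, a highest weight module with highest weight $\lambda$ is a $\mathfrak{gl}(V)$-module generated by a nonzero homogeneous vector $v$ with $\mathfrak n v=0$ and $hv=\lambda(h)v$ for all $h\in\mathfrak h$. Let $(\varepsilon_a)$ be the basis of $\mathfrak h^*$ with $\varepsilon_a(E_{bb})=\delta_{ab}$, equip $\mathfrak h^*$ with the bilinear form $(\varepsilon_a,\varepsilon_b)=\omega_a\delta_{ab}$, put $\Phi_0^+=\{\varepsilon_a-\varepsilon_b\mid a<b,\ \omega_a\omega_b=1\}$, and let $$\Lambda_{M_+|M_-}=\Big\{\lambda\in\mathfrak h^*\ \Big|\ \tfrac{2(\lambda,\Upsilon)}{(\Upsilon,\Upsilon)}\in\mathbb Z_{\ge0}\ \text{ for all }\Upsilon\in\Phi^+_0\Big\}.$$ (Here $M_\pm$ is the number of labels $a$ with $\omega_a=\pm1$.) Theorem. (1) Every finite-dimensional simple $\mathfrak{gl}(V)$-module is a highest weight module, for some highest weight $\lambda\in\mathfrak h^*$. (2) For every $\lambda\in\mathfrak h^*$ there is a simple $\mathfrak{gl}(V)$-module $L_\lambda$ with highest weight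 $\lambda$; and every simple $\mathfrak{gl}(V)$-module with highest weight $\lambda$ is finite-dimensional if and only if $\lambda\in\Lambda_{M_+|M_-}$. -/

import Mathlib

universe uG uV uL uI

noncomputable section

namespace ColourLie

/-- A commutative factor on the additive abelian group `Γ`, with values in the nonzero complex
numbers. -/
structure IsCommutativeFactor {Γ : Type uG} [AddCommGroup Γ] (ω : Γ → Γ → ℂˣ) : Prop where
  symm : ∀ α β, ω α β = (ω β α)⁻¹
  map_add_right : ∀ α β γ, ω α (β + γ) = ω α β * ω α γ
  map_add_left : ∀ α β γ, ω (α + β) γ = ω α γ * ω β γ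

/-! ### Graded vector spaces, homogeneous bases and distinguished orders -/

/-- `Γ_R`: the set of those degrees whose homogeneous component is nonzero. -/
abbrev GammaR {Γ : Type uG} {V : Type uV} [AddCommGroup V] [Module ℂ V]
    (𝒱 : Γ → Submodule ℂ V) : Type uG :=
  {α : Γ // 𝒱 α ≠ ⊥}

/-- A total order on `Γ_R` is distinguished if every `α` with `ω(α,α) = 1` precedes every `β` with
`ω(β,β) = -1`. -/
def IsDistinguished {Γ : Type uG} {V : Type uV} [AddCommGroup V] [Module ℂ V]
    (ω : Γ → Γ → ℂˣ) (𝒱 : Γ → Submodule ℂ V) [LinearOrder (GammaR 𝒱)] : Prop :=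
  ∀ α β : GammaR 𝒱, ω α α = 1 → ω β β = -1 → α < β

/-- The labels `(α, i)` with `α ∈ Γ_R` and `1 ≤ i ≤ dim V_α` (counted from `0` here), ordered
lexicographically: first by `α`, then by `i`. -/
abbrev BasisIndex {Γ : Type uG} {V : Type uV} [AddCommGroup V] [Module ℂ V]
    (𝒱 : Γ → Submodule ℂ V) : Type uG :=
  Σₗ α : GammaR 𝒱, Fin (Module.finrank ℂ (𝒱 α))

/-- The degree of the basis vector `e(α)_i` is `α`. -/
def BasisIndex.deg {Γ : Type uG} {V : Type uV} [AddCommGroup V] [Module ℂ V]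
    {𝒱 : Γ → Submodule ℂ V} (a : BasisIndex 𝒱) : Γ :=
  ((ofLex a).1 : Γ)

/-- The basis `e(α)_i` of `V` obtained by joining ordered bases of all nonzero homogeneous
components. -/
def homogeneousBasis {Γ : Type uG} [DecidableEq Γ] {V : Type uV} [AddCommGroup V] [Module ℂ V]
    {𝒱 : Γ → Submodule ℂ V} (hV : DirectSum.IsInternal 𝒱)
    (B : ∀ α : GammaR 𝒱, Module.Basis (Fin (Module.finrank ℂ (𝒱 α))) ℂ (𝒱 α)) :
    Module.Basis (BasisIndex 𝒱) ℂ V :=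
  (((DirectSum.isInternal_ne_bot_iff (A := 𝒱)).mpr hV).collectedBasis B).reindex toLex

theorem homogeneousBasis_apply {Γ : Type uG} [DecidableEq Γ] {V : Type uV} [AddCommGroup V]
    [Module ℂ V] {𝒱 : Γ → Submodule ℂ V} (hV : DirectSum.IsInternal 𝒱)
    (B : ∀ α : GammaR 𝒱, Module.Basis (Fin (Module.finrank ℂ (𝒱 α))) ℂ (𝒱 α))
    (a : BasisIndex 𝒱) :
    homogeneousBasis hV B a = (B (ofLex a).1 (ofLex a).2 : V) := by
  simp [homogeneousBasis]

/-! ### The general linear Lie `(Γ, ω)`-algebra and its modules -/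

/-- The component of degree `α` of `gl(V) = End(V)`: endomorphisms that map `V_β` into `V_{α+β}`
for every `β`. -/
def glDeg {Γ : Type uG} [AddCommGroup Γ] {V : Type uV} [AddCommGroup V] [Module ℂ V]
    (𝒱 : Γ → Submodule ℂ V) (α : Γ) : Submodule ℂ (Module.End ℂ V) where
  carrier := {X | ∀ β, ∀ v ∈ 𝒱 β, X v ∈ 𝒱 (α + β)}
  add_mem' hX hY β v hv := by
    simpa using (𝒱 (α + β)).add_mem (hX β v hv) (hY β v hv)
  zero_mem' β v _ := by simp
  smul_mem' c X hX β v hv := by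
    simpa using (𝒱 (α + β)).smul_mem c (hX β v hv)

/-- The `(Γ, ω)`-commutator `[X, Y] = X Y - ω(α, β) Y X` of homogeneous endomorphisms `X`, `Y` of
degrees `α`, `β`. -/
def glBracket {Γ : Type uG} {V : Type uV} [AddCommGroup V] [Module ℂ V]
    (ω : Γ → Γ → ℂˣ) (α β : Γ) (X Y : Module.End ℂ V) : Module.End ℂ V :=
  X * Y - (ω α β : ℂ) • (Y * X)

/-- `ρ` makes `L = ⨁ L_γ` a `Γ`-graded module over the Lie `(Γ, ω)`-algebra `gl(V)`. -/
structure IsGradedGlModule {Γ : Type uG} [AddCommGroup Γ] [DecidableEq Γ] {V : Type uV}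
    [AddCommGroup V] [Module ℂ V] (ω : Γ → Γ → ℂˣ) (𝒱 : Γ → Submodule ℂ V) {L : Type uL}
    [AddCommGroup L] [Module ℂ L] (𝓛 : Γ → Submodule ℂ L)
    (ρ : Module.End ℂ V →ₗ[ℂ] Module.End ℂ L) : Prop where
  isInternal : DirectSum.IsInternal 𝓛
  map_mem : ∀ α β, ∀ X ∈ glDeg 𝒱 α, ∀ v ∈ 𝓛 β, ρ X v ∈ 𝓛 (α + β)
  map_bracket : ∀ α β, ∀ X ∈ glDeg 𝒱 α, ∀ Y ∈ glDeg 𝒱 β,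
    ρ X * ρ Y - (ω α β : ℂ) • (ρ Y * ρ X) = ρ (glBracket ω α β X Y)

/-- `W` is stable under the action `ρ` of `gl(V)`. -/
def IsStable {V : Type uV} [AddCommGroup V] [Module ℂ V] {L : Type uL}
    [AddCommGroup L] [Module ℂ L] (ρ : Module.End ℂ V →ₗ[ℂ] Module.End ℂ L)
    (W : Submodule ℂ L) : Prop :=
  ∀ X, ∀ v ∈ W, ρ X v ∈ W

/-- The subspace `W` of `L` is graded: it is the sum of its intersections with the `L_γ`. -/
def IsGradedSubspace {Γ : Type uG} {L : Type uL} [AddCommGroup L] [Module ℂ L]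
    (𝓛 : Γ → Submodule ℂ L) (W : Submodule ℂ L) : Prop :=
  W = ⨆ γ, W ⊓ 𝓛 γ

/-- A simple `Γ`-graded `gl(V)`-module: it is nonzero, and its only graded submodules are zero and
itself. -/
structure IsSimpleGlModule {Γ : Type uG} [AddCommGroup Γ] [DecidableEq Γ] {V : Type uV}
    [AddCommGroup V] [Module ℂ V] (ω : Γ → Γ → ℂˣ) (𝒱 : Γ → Submodule ℂ V) {L : Type uL}
    [AddCommGroup L] [Module ℂ L] (𝓛 : Γ → Submodule ℂ L)
    (ρ : Module.End ℂ V →ₗ[ℂ] Module.End ℂ L) : Prop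
    extends IsGradedGlModule ω 𝒱 𝓛 ρ where
  nontrivial : Nontrivial L
  eq_bot_or_eq_top : ∀ W : Submodule ℂ L, IsStable ρ W → IsGradedSubspace 𝓛 W → W = ⊥ ∨ W = ⊤

/-! ### Triangular decomposition, roots and weights

Here `e` is an ordered basis of `V`; `d a` is the degree of the basis vector `e a`. -/

section Roots

variable {V : Type uV} [AddCommGroup V] [Module ℂ V] {ι : Type uI}

/-- The matrix unit `E_{ab}`, which maps `e b` to `e a` and every other basis vector to zero. -/
def matrixUnit (e : Module.Basis ι ℂ V) (a b : ι) : Module.End ℂ V :=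
  (e.coord b).smulRight (e a)

/-- The Cartan subalgebra `𝔥`, spanned by the diagonal matrix units. -/
def cartan (e : Module.Basis ι ℂ V) : Submodule ℂ (Module.End ℂ V) :=
  Submodule.span ℂ (Set.range fun a => matrixUnit e a a)

/-- The subalgebra `𝔫`, the sum of the root spaces of the positive roots, spanned by the matrix
units `E_{ab}` with `a < b`. -/
def nilradical [LT ι] (e : Module.Basis ι ℂ V) : Submodule ℂ (Module.End ℂ V) :=
  Submodule.span ℂ {X | ∃ a b, a < b ∧ X = matrixUnit e a b}

/-- `E_{aa}` as an element of the Cartan subalgebra. -/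
def cartanUnit (e : Module.Basis ι ℂ V) (a : ι) : cartan e :=
  ⟨matrixUnit e a a, Submodule.subset_span ⟨a, rfl⟩⟩

/-- The weight `ε_a`, with `ε_a(E_{bb}) = δ_{ab}`: it reads off the `a`-th diagonal entry. -/
def eps (e : Module.Basis ι ℂ V) (a : ι) : Module.Dual ℂ (cartan e) :=
  ((e.coord a).comp (LinearMap.applyₗ (e a))).comp (cartan e).subtype

/-- The bilinear form on `𝔥^*` with `(ε_a, ε_b) = δ_{ab} ω(d a, d a)`, induced by the `ω`-trace
form on `gl(V)`. It is used only when `ι` is finite, and then the sum is an ordinary one. -/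
def weightForm {Γ : Type uG} (ω : Γ → Γ → ℂˣ) (e : Module.Basis ι ℂ V) (d : ι → Γ)
    (μ ν : Module.Dual ℂ (cartan e)) : ℂ :=
  ∑ᶠ a, (ω (d a) (d a) : ℂ) * μ (cartanUnit e a) * ν (cartanUnit e a)

/-- `Φ⁺₀`: the positive roots `ε_a - ε_b`, `a < b`, with `ω(d a, d a) ω(d b, d b) = 1`. -/
def evenPositiveRoots {Γ : Type uG} (ω : Γ → Γ → ℂˣ) [LT ι] (e : Module.Basis ι ℂ V)
    (d : ι → Γ) : Set (Module.Dual ℂ (cartan e)) :=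
  {Υ | ∃ a b, a < b ∧ ω (d a) (d a) * ω (d b) (d b) = 1 ∧ Υ = eps e a - eps e b}

/-- `Λ_{M₊|M₋}`: the weights `lam` such that `2 (lam, Υ) / (Υ, Υ)` is a nonnegative integer for all
`Υ ∈ Φ⁺₀`. -/
def dominantWeights {Γ : Type uG} (ω : Γ → Γ → ℂˣ) [LT ι] (e : Module.Basis ι ℂ V)
    (d : ι → Γ) : Set (Module.Dual ℂ (cartan e)) :=
  {lam | ∀ Υ ∈ evenPositiveRoots ω e d,
    ∃ n : ℕ, 2 * weightForm ω e d lam Υ / weightForm ω e d Υ Υ = n}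

/-- `v` is a (homogeneous) highest weight vector of weight `lam`. -/
structure IsHighestWeightVector {Γ : Type uG} [LT ι] (e : Module.Basis ι ℂ V)
    (lam : Module.Dual ℂ (cartan e)) {L : Type uL} [AddCommGroup L] [Module ℂ L]
    (𝓛 : Γ → Submodule ℂ L) (ρ : Module.End ℂ V →ₗ[ℂ] Module.End ℂ L) (v : L) : Prop where
  ne_zero : v ≠ 0
  homogeneous : ∃ γ, v ∈ 𝓛 γ
  nilradical_smul : ∀ X ∈ nilradical e, ρ X v = 0
  cartan_smul : ∀ h : cartan e, ρ h v = lam h • v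

/-- The module is a highest weight module of highest weight `lam`: it is generated by a highest
weight vector of weight `lam`. -/
def IsHighestWeightModule {Γ : Type uG} [LT ι] (e : Module.Basis ι ℂ V)
    (lam : Module.Dual ℂ (cartan e)) {L : Type uL} [AddCommGroup L] [Module ℂ L]
    (𝓛 : Γ → Submodule ℂ L) (ρ : Module.End ℂ V →ₗ[ℂ] Module.End ℂ L) : Prop :=
  ∃ v, IsHighestWeightVector e lam 𝓛 ρ v ∧ ∀ W : Submodule ℂ L, IsStable ρ W → v ∈ W → W = ⊤

end Roots

end ColourLie

end

noncomputable section

namespace ColourLie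

/-! ### Commutative factors -/

namespace IsCommutativeFactor

variable {Γ : Type*} [AddCommGroup Γ] {ω : Γ → Γ → ℂˣ}

/-! The argument runs on operators `E i j` obeying the relations of the matrix units
(`IsMatrixUnitRep`) and uses neither an enveloping algebra nor a PBW theorem. Simplicity is tested
on graded submodules only, but this suffices for every nonzero homogeneous vector to generate
(`IsSimpleGlModule.isCyclicVector`).

Weights are compared through a height `H = ∑ p i • E i i` with `p` strictly increasing and natural:
`E i j` shifts its eigenvalues by `p i - p j`, so raising operators decrease it. In a
finite-dimensional module a homogeneous joint eigenvector of the `E i i` whose `H`-eigenvalue has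
least real part is therefore singular, and (1) follows.

Necessity of dominance is `sl₂` theory: for an even root the colour factor between `E a b` and `E b
a` is `1`, and the last nonzero `E b a ^ k` applied to the highest weight vector `v` forces `lam a -
lam b = k`.

For sufficiency, all lowering operators are shown to be locally nilpotent. Odd ones square to zero.
For an even simple root with `lam a - lam b = n`, the vector `E b a ^ (n + 1)` applied to `v` is
singular; if nonzero it would generate, hence have least height, although `v` lies strictly below
it. The distinguished order makes labels of equal parity an interval, so the other even root vectors
are colour commutators of shorter even ones, and local nilpotency passes to them by a Heisenberg
computation (`locallyNilpotentPart_commutator`). Adjoining the lowering operators one at a time to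
`span {v}` then gives a finite-dimensional subspace stable under all of them, and this is the whole
module (`IsMatrixUnitRep.eq_top_of_lowering_stable`).

Existence for arbitrary `lam` uses an explicit model by induction on the number of labels: `gl(n+1)`
acts by differential operators on a colour Fock space tensored with a `gl(n)`-module
(`IsWeylSystem.extendRep`, `exists_graded_singularVector`), with the vacuum tensored with the old
singular vector as new singular vector. The submodule it generates has a simple graded quotient by
Zorn's lemma. -/

theorem zero_left (hω : IsCommutativeFactor ω) (x : Γ) : ω 0 x = 1 := by
  have := hω.map_add_left 0 0 x
  simpa using this

theorem zero_right (hω : IsCommutativeFactor ω) (x : Γ) : ω x 0 = 1 := by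
  have := hω.map_add_right x 0 0
  simpa using this

theorem neg_left (hω : IsCommutativeFactor ω) (x y : Γ) : ω (-x) y = (ω x y)⁻¹ := by
  have := hω.map_add_left x (-x) y
  rw [add_neg_cancel, hω.zero_left] at this
  exact (inv_eq_of_mul_eq_one_right this.symm).symm

theorem neg_right (hω : IsCommutativeFactor ω) (x y : Γ) : ω x (-y) = (ω x y)⁻¹ := by
  rw [hω.symm, hω.neg_left, hω.symm y x, inv_inv]

theorem sub_left (hω : IsCommutativeFactor ω) (x y z : Γ) :
    ω (x - y) z = ω x z * (ω y z)⁻¹ := by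
  rw [sub_eq_add_neg, hω.map_add_left, hω.neg_left]

theorem sub_right (hω : IsCommutativeFactor ω) (x y z : Γ) :
    ω x (y - z) = ω x y * (ω x z)⁻¹ := by
  rw [sub_eq_add_neg, hω.map_add_right, hω.neg_right]

theorem mul_swap (hω : IsCommutativeFactor ω) (x y : Γ) : ω x y * ω y x = 1 := by
  rw [hω.symm x y, inv_mul_cancel]

theorem self_mul_self (hω : IsCommutativeFactor ω) (x : Γ) : ω x x * ω x x = 1 :=
  hω.mul_swap x x

theorem self_eq_one_or (hω : IsCommutativeFactor ω) (x : Γ) : ω x x = 1 ∨ ω x x = -1 := by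
  have h : (ω x x : ℂ) * ω x x = 1 := by
    rw [← Units.val_mul, hω.self_mul_self x, Units.val_one]
  rcases mul_self_eq_one_iff.mp h with h | h
  · exact Or.inl (Units.ext h)
  · exact Or.inr (Units.ext (by simpa using h))

/-- The cross terms `ω x y` and `ω y x` are mutually inverse and cancel. Hence the parity of a root
vector is the product of the parities of its two labels. -/
theorem sub_sub_self (hω : IsCommutativeFactor ω) (x y : Γ) :
    ω (x - y) (x - y) = ω x x * ω y y := by
  rw [hω.sub_left, hω.sub_right, hω.sub_right, hω.symm y x]
  have h := hω.self_mul_self y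
  have : (ω y y)⁻¹ = ω y y := inv_eq_of_mul_eq_one_right h
  rw [mul_inv_rev, this]
  rw [inv_inv, this, mul_mul_mul_comm, inv_mul_cancel, mul_one]

end IsCommutativeFactor

/-! ### Families of operators that satisfy the relations of the matrix units -/

/-- The operators `E i j` satisfy the `(Γ, ω)`-commutation relations of the matrix units of
`gl(V)`, where `d i` is the degree of the `i`-th basis vector of `V`. -/
def IsMatrixUnitRep {Γ ι M : Type*} [AddCommGroup Γ] [DecidableEq ι] [AddCommGroup M] [Module ℂ M]
    (ω : Γ → Γ → ℂˣ) (d : ι → Γ) (E : ι → ι → Module.End ℂ M) : Prop :=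
  ∀ i j k l, E i j * E k l - (ω (d i - d j) (d k - d l) : ℂ) • (E k l * E i j) =
    (if j = k then E i l else 0) -
      (ω (d i - d j) (d k - d l) : ℂ) • (if l = i then E k j else 0)

/-- The vectors annihilated by some power of `T`. -/
def locallyNilpotentPart {M : Type*} [AddCommGroup M] [Module ℂ M] (T : Module.End ℂ M) :
    Submodule ℂ M where
  carrier := {u | ∃ k, (T ^ k) u = 0}
  zero_mem' := ⟨0, by simp⟩
  add_mem' := by
    rintro u v ⟨k, hk⟩ ⟨l, hl⟩
    refine ⟨k + l, ?_⟩
    rw [map_add]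
    nth_rewrite 1 [add_comm k l]
    rw [pow_add, pow_add, Module.End.mul_apply, Module.End.mul_apply, hk, hl]
    simp
  smul_mem' := by
    rintro c u ⟨k, hk⟩
    exact ⟨k, by rw [map_smul, hk, smul_zero]⟩

/-! ### Local nilpotency and colour commutators -/

section LocallyNilpotent

variable {M : Type*} [AddCommGroup M] [Module ℂ M]

theorem mem_locallyNilpotentPart_of_apply_mem {T : Module.End ℂ M} {u : M}
    (h : T u ∈ locallyNilpotentPart T) : u ∈ locallyNilpotentPart T := by
  obtain ⟨k, hk⟩ := h
  exact ⟨k + 1, by rw [pow_succ, Module.End.mul_apply, hk]⟩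

theorem apply_mem_locallyNilpotentPart {T : Module.End ℂ M} {u : M}
    (h : u ∈ locallyNilpotentPart T) : T u ∈ locallyNilpotentPart T := by
  obtain ⟨k, hk⟩ := h
  refine ⟨k, ?_⟩
  rw [← Module.End.mul_apply, ← pow_succ, pow_succ', Module.End.mul_apply, hk, map_zero]

/-- In `T (X u) = c • X (T u) + Y u` the vector `T u` needs one power of `T` fewer than `u`, so
induction on the exponent applies. -/
theorem locallyNilpotentPart_stable {T X Y : Module.End ℂ M} {c : ℂ}
    (hXY : T * X - c • (X * T) = Y)
    (hY : ∀ u ∈ locallyNilpotentPart T, Y u ∈ locallyNilpotentPart T) :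
    ∀ u ∈ locallyNilpotentPart T, X u ∈ locallyNilpotentPart T := by
  rintro u ⟨k, hk⟩
  induction k generalizing u with
  | zero =>
    have : u = 0 := by simpa using hk
    rw [this, map_zero]
    exact Submodule.zero_mem _
  | succ k ih =>
    apply mem_locallyNilpotentPart_of_apply_mem
    have h : T (X u) = c • X (T u) + Y u := by
      rw [← hXY]; simp
    rw [h]
    refine Submodule.add_mem _ (Submodule.smul_mem _ _ (ih _ ?_)) (hY _ ⟨k + 1, hk⟩)
    rwa [← Module.End.mul_apply, ← pow_succ]

/-- Each `y` that `x` passes leaves a `z`, and the powers of `c` so produced are absorbed exactly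
when `z` is moved to the front. Hence the coefficient is the ordinary integer `q + 1`, never zero,
and not a `c`-analogue of it. -/
theorem mul_pow_of_commutator {x y z : Module.End ℂ M} {c : ℂ}
    (h : x * y - c • (y * x) = z) (hzy : z * y = c • (y * z)) (q : ℕ) :
    x * y ^ (q + 1) = c ^ (q + 1) • (y ^ (q + 1) * x) + ((q : ℂ) + 1) • (z * y ^ q) := by
  have hx : x * y = c • (y * x) + z := by rw [← h]; abel
  induction q with
  | zero => simp [hx]
  | succ q ih =>
    have hz : c • (y * (z * y ^ q)) = z * y ^ (q + 1) := by
      rw [pow_succ', ← mul_assoc z, hzy, smul_mul_assoc, mul_assoc]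
    calc x * y ^ (q + 1 + 1) = (x * y) * y ^ (q + 1) := by rw [pow_succ' y (q + 1), mul_assoc]
      _ = c • (y * (x * y ^ (q + 1))) + z * y ^ (q + 1) := by
          rw [hx, add_mul, smul_mul_assoc, mul_assoc]
      _ = c ^ (q + 1 + 1) • (y ^ (q + 1 + 1) * x) +
            ((q : ℂ) + 1) • (c • (y * (z * y ^ q))) + z * y ^ (q + 1) := by
          rw [ih, mul_add, smul_add, mul_smul_comm, mul_smul_comm, smul_smul, ← pow_succ',
            ← mul_assoc y, ← pow_succ' y, smul_comm c]
      _ = _ := by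
          rw [hz, add_assoc]
          congr 1
          push_cast
          module

/-- If `x` and `y` are locally nilpotent and `x`, `y`, `z = [x, y]` span a colour Heisenberg
algebra, then `z` is locally nilpotent. -/
theorem locallyNilpotentPart_commutator {x y z : Module.End ℂ M} {c c' : ℂ} (hc' : c' ≠ 0)
    (h : x * y - c • (y * x) = z) (hxz : x * z = c' • (z * x)) (hzy : z * y = c • (y * z))
    (hx : locallyNilpotentPart x = ⊤) (hy : locallyNilpotentPart y = ⊤) :
    locallyNilpotentPart z = ⊤ := by
  rw [eq_top_iff]
  rintro u -
  obtain ⟨m, hm⟩ : u ∈ locallyNilpotentPart x := hx ▸ Submodule.mem_top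
  have hy' : ∀ u, ∃ p, (y ^ p) u = 0 := fun u ↦
    (hy ▸ Submodule.mem_top : u ∈ locallyNilpotentPart y)
  choose f hf using hy'
  -- Only finitely many `x ^ j` fail to kill `u`, so one power of `y` serves for all `j`.
  have key : ∃ p, ∀ j, (y ^ p) ((x ^ j) u) = 0 := by
    refine ⟨∑ j ∈ Finset.range m, f ((x ^ j) u), fun j ↦ ?_⟩
    rcases lt_or_ge j m with hj | hj
    · obtain ⟨r, hr⟩ := Nat.exists_eq_add_of_le (Finset.single_le_sum
        (f := fun j ↦ f ((x ^ j) u)) (fun _ _ ↦ Nat.zero_le _) (Finset.mem_range.mpr hj))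
      rw [hr, add_comm, pow_add, Module.End.mul_apply, hf, map_zero]
    · obtain ⟨r, rfl⟩ := Nat.exists_eq_add_of_le hj
      rw [add_comm m r, pow_add, Module.End.mul_apply, hm, map_zero, map_zero]
  obtain ⟨p, hp⟩ := key
  have hxzk : ∀ k, x * z ^ k = c' ^ k • (z ^ k * x) := by
    intro k
    induction k with
    | zero => simp
    | succ k ih =>
      rw [pow_succ, ← mul_assoc, ih, smul_mul_assoc, mul_assoc, hxz, mul_smul_comm, smul_smul,
        ← mul_assoc, pow_succ]
  -- Applying `x` to the vanishing of `z ^ k y ^ (q + 1) x ^ j u` trades one `y` for one `z`; the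
  -- other term involves `x ^ (j + 1) u` and vanishes by the same hypothesis, which is why `j` is
  -- kept general.
  have claim : ∀ k q, k + q = p → ∀ j, (z ^ k) ((y ^ q) ((x ^ j) u)) = 0 := by
    intro k
    induction k with
    | zero =>
      rintro q rfl j
      simpa using hp j
    | succ k ih =>
      intro q hq j
      have h1 := ih (q + 1) (by omega)
      have h2 : (x * z ^ k * y ^ (q + 1)) ((x ^ j) u) = 0 := by
        simp only [Module.End.mul_apply, h1, map_zero]
      rw [hxzk, smul_mul_assoc, mul_assoc, mul_pow_of_commutator h hzy, LinearMap.smul_apply,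
        smul_eq_zero] at h2
      have h3 := h2.resolve_left (pow_ne_zero _ hc')
      rw [mul_add, LinearMap.add_apply, mul_smul_comm, mul_smul_comm, LinearMap.smul_apply,
        LinearMap.smul_apply, ← mul_assoc, ← mul_assoc, Module.End.mul_apply _ x,
        Module.End.mul_apply (z ^ k), ← Module.End.mul_apply x, ← pow_succ', h1, smul_zero,
        zero_add, smul_eq_zero, ← pow_succ] at h3
      exact h3.resolve_left (by exact_mod_cast Nat.succ_ne_zero q)
  refine ⟨p, ?_⟩
  simpa using claim p 0 (by simp) 0

/-- A finite-dimensional subspace stable under a family of operators stays finite-dimensional when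
it is saturated under a locally nilpotent operator that normalizes the span of the family. -/
theorem exists_finiteDimensional_stable_insert {T : Module.End ℂ M}
    (hT : locallyNilpotentPart T = ⊤) (S : Set (Module.End ℂ M)) {U : Submodule ℂ M}
    [FiniteDimensional ℂ U] (hU : ∀ X ∈ S, ∀ u ∈ U, X u ∈ U)
    (hS : ∀ X ∈ S, ∃ c : ℂ, X * T - c • (T * X) ∈ Submodule.span ℂ S) :
    ∃ U' : Submodule ℂ M, FiniteDimensional ℂ U' ∧ U ≤ U' ∧ (∀ X ∈ S, ∀ u ∈ U', X u ∈ U') ∧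
      ∀ u ∈ U', T u ∈ U' := by
  obtain ⟨K, hK⟩ : ∃ K, U ≤ LinearMap.ker (T ^ K) := by
    obtain ⟨s, hs'⟩ := (Submodule.fg_iff_finiteDimensional U).mpr inferInstance
    have hT' : ∀ u, ∃ p, (T ^ p) u = 0 := fun u ↦
      (hT ▸ Submodule.mem_top : u ∈ locallyNilpotentPart T)
    choose f hf using hT'
    refine ⟨∑ u ∈ s, f u, ?_⟩
    rw [← hs', Submodule.span_le]
    intro u hu
    obtain ⟨r, hr⟩ := Nat.exists_eq_add_of_le (Finset.single_le_sum
        (f := f) (fun _ _ ↦ Nat.zero_le _) hu)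
    rw [SetLike.mem_coe, LinearMap.mem_ker, hr, add_comm, pow_add, Module.End.mul_apply, hf,
      map_zero]
  -- `T ^ K` kills `U`, so this finite sum already contains every `T ^ k` image of `U`.
  set U' : Submodule ℂ M := ⨆ k : Fin K, U.map (T ^ (k : ℕ)) with hU'
  have hmem : ∀ k, ∀ u ∈ U, (T ^ k) u ∈ U' := by
    intro k u hu
    rcases lt_or_ge k K with hk | hk
    · exact Submodule.mem_iSup_of_mem (⟨k, hk⟩ : Fin K) (Submodule.mem_map_of_mem hu)
    · obtain ⟨r, rfl⟩ := Nat.exists_eq_add_of_le hk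
      rw [add_comm, pow_add, Module.End.mul_apply, LinearMap.mem_ker.mp (hK hu), map_zero]
      exact Submodule.zero_mem _
  have hTU : ∀ u ∈ U', T u ∈ U' := by
    have : U' ≤ U'.comap T := by
      rw [hU', iSup_le_iff]
      rintro k
      rw [Submodule.map_le_iff_le_comap]
      intro u hu
      rw [Submodule.mem_comap, Submodule.mem_comap, ← Module.End.mul_apply, ← pow_succ']
      exact hmem _ _ hu
    exact this
  have hspan : ∀ X ∈ Submodule.span ℂ S, ∀ u ∈ U, X u ∈ U := by
    intro X hX u hu
    induction hX using Submodule.span_induction with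
    | mem X hX => exact hU X hX u hu
    | zero => exact U.zero_mem
    | add X Y _ _ hX hY => exact U.add_mem hX hY
    | smul c X _ hX => exact U.smul_mem c hX
  -- Quantifying over the span, not just `S`, lets the induction hypothesis absorb the commutator `X
  -- * T - c • (T * X)`.
  have claim : ∀ k, ∀ u ∈ U, ∀ X ∈ Submodule.span ℂ S, X ((T ^ k) u) ∈ U' := by
    intro k u hu
    induction k with
    | zero =>
      intro X hX
      simpa using hmem 0 _ (hspan X hX u hu)
    | succ k ih =>
      intro X hX
      induction hX using Submodule.span_induction with
      | mem X hX =>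
        obtain ⟨c, hc⟩ := hS X hX
        have e : X ((T ^ (k + 1)) u) =
            c • T (X ((T ^ k) u)) + (X * T - c • (T * X)) ((T ^ k) u) := by
          rw [pow_succ']; simp
        rw [e]
        exact U'.add_mem (U'.smul_mem _ (hTU _ (ih _ (Submodule.subset_span hX)))) (ih _ hc)
      | zero => exact U'.zero_mem
      | add X Y _ _ hX hY => exact U'.add_mem hX hY
      | smul c X _ hX => exact U'.smul_mem c hX
  refine ⟨U', inferInstance, fun u hu ↦ by simpa using hmem 0 u hu, fun X hX ↦ ?_, hTU⟩
  have : U' ≤ U'.comap X := by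
    rw [hU', iSup_le_iff]
    rintro k
    rw [Submodule.map_le_iff_le_comap]
    intro u hu
    exact claim _ u hu X (Submodule.subset_span hX)
  exact this

end LocallyNilpotent

/-! ### Highest weight vectors for operators satisfying the matrix unit relations -/

/-- Every subspace that contains `v` and is stable under all `E i j` is the whole space. -/
def IsCyclicVector {ι M : Type*} [AddCommGroup M] [Module ℂ M] (E : ι → ι → Module.End ℂ M)
    (v : M) : Prop :=
  ∀ W : Submodule ℂ M, (∀ i j, ∀ u ∈ W, E i j u ∈ W) → v ∈ W → W = ⊤

/-- `v` is annihilated by all `E i j` with `i < j` and is an eigenvector of `E i i` with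
eigenvalue `lam i`. -/
structure IsSingularVector {ι M : Type*} [LT ι] [AddCommGroup M] [Module ℂ M]
    (E : ι → ι → Module.End ℂ M) (lam : ι → ℂ) (v : M) : Prop where
  raise : ∀ i j, i < j → E i j v = 0
  diag : ∀ i, E i i v = lam i • v

section

variable {Γ ι M : Type*} [AddCommGroup Γ] {ω : Γ → Γ → ℂˣ} [AddCommGroup M] [Module ℂ M]
  {d : ι → Γ} {E : ι → ι → Module.End ℂ M}

theorem IsMatrixUnitRep.apply_apply [DecidableEq ι] (hE : IsMatrixUnitRep ω d E) (i j k l : ι)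
    (u : M) :
    E i j (E k l u) = (ω (d i - d j) (d k - d l) : ℂ) • E k l (E i j u) +
      ((if j = k then E i l u else 0) -
      (ω (d i - d j) (d k - d l) : ℂ) • (if l = i then E k j u else 0)) := by
  have := congrArg (fun f : Module.End ℂ M ↦ f u) (hE i j k l)
  simp only [LinearMap.sub_apply, Module.End.mul_apply, LinearMap.smul_apply] at this
  rw [sub_eq_iff_eq_add'] at this
  rw [this]
  congr 2
  · split_ifs <;> rfl
  · split_ifs <;> rfl

theorem IsMatrixUnitRep.diag_apply [DecidableEq ι] (hω : IsCommutativeFactor ω)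
    (hE : IsMatrixUnitRep ω d E) (i k l : ι) (u : M) :
    E i i (E k l u) = E k l (E i i u) + ((if i = k then E k l u else 0) -
      (if l = i then E k l u else 0)) := by
  rw [hE.apply_apply, sub_self, hω.zero_left, Units.val_one, one_smul, one_smul]
  congr 2
  · split_ifs with h <;> simp [h]
  · split_ifs with h <;> simp [h]

/-- Repeated colour commutation with `E a b` leads from any matrix unit, in a few steps, to zero or
to a multiple of `E a b`. The longest chain goes from `E b a` through a combination of `E a a` and
`E b b` to `E a b`. -/
theorem IsMatrixUnitRep.locallyNilpotentPart_stable [DecidableEq ι] (hE : IsMatrixUnitRep ω d E) {a b : ι} (hab : a ≠ b)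
    (k l : ι) : ∀ u ∈ locallyNilpotentPart (E a b), E k l u ∈ locallyNilpotentPart (E a b) := by
  have hself : ∀ u ∈ locallyNilpotentPart (E a b), E a b u ∈ locallyNilpotentPart (E a b) :=
    fun u hu ↦ apply_mem_locallyNilpotentPart hu
  have hr := hE a b
  by_cases hbk : b = k
  · subst hbk
    by_cases hla : l = a
    · subst hla
      refine ColourLie.locallyNilpotentPart_stable (hr b l) ?_
      have h1 : ∀ u ∈ locallyNilpotentPart (E l b), E l l u ∈ locallyNilpotentPart (E l b) := by
        refine ColourLie.locallyNilpotentPart_stable (hr l l) fun u hu ↦ ?_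
        simpa [hab, hab.symm] using hself u hu
      have h2 : ∀ u ∈ locallyNilpotentPart (E l b), E b b u ∈ locallyNilpotentPart (E l b) := by
        refine ColourLie.locallyNilpotentPart_stable (hr b b) fun u hu ↦ ?_
        simpa [hab, hab.symm] using hself u hu
      intro u hu
      simpa using Submodule.sub_mem _ (h1 u hu) (Submodule.smul_mem _ _ (h2 u hu))
    · refine ColourLie.locallyNilpotentPart_stable (hr b l) ?_
      simp only [if_true, if_neg hla, smul_zero, sub_zero]
      refine ColourLie.locallyNilpotentPart_stable (hr a l) ?_
      simp [hab.symm, hla]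
  · by_cases hla : l = a
    · subst hla
      refine ColourLie.locallyNilpotentPart_stable (hr k l) ?_
      simp only [if_true, if_neg hbk, zero_sub]
      have h1 : ∀ u ∈ locallyNilpotentPart (E l b), E k b u ∈ locallyNilpotentPart (E l b) := by
        refine ColourLie.locallyNilpotentPart_stable (hr k b) ?_
        simp [hab.symm, hbk]
      intro u hu
      simpa using h1 u hu
    · refine ColourLie.locallyNilpotentPart_stable (hr k l) ?_
      simp [hbk, hla]

/-- For an odd root the colour factor is `-1`, so the bracket of the root vector with itself is
twice its square; the right-hand side of the relation vanishes because `a ≠ b`. -/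
theorem IsMatrixUnitRep.mul_self_eq_zero [DecidableEq ι] (hω : IsCommutativeFactor ω)
    (hE : IsMatrixUnitRep ω d E) {a b : ι} (hab : a ≠ b)
    (hodd : ω (d a) (d a) * ω (d b) (d b) ≠ 1) : E a b * E a b = 0 := by
  have h := hE a b a b
  rw [hω.sub_sub_self] at h
  have h' : ω (d a) (d a) * ω (d b) (d b) = -1 := by
    rw [← hω.sub_sub_self] at hodd ⊢
    exact (hω.self_eq_one_or _).resolve_left hodd
  rw [h', if_neg hab.symm] at h
  simp only [Units.val_neg, Units.val_one, neg_smul, one_smul, sub_neg_eq_add, smul_zero,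
    sub_zero, ← two_smul ℂ, smul_eq_zero, OfNat.ofNat_ne_zero, false_or] at h
  exact h

end

/-! ### Generation by lowering operators, and the height -/

section

variable {Γ ι M : Type*} [AddCommGroup Γ] {ω : Γ → Γ → ℂˣ} [LinearOrder ι] [AddCommGroup M]
  [Module ℂ M] {d : ι → Γ} {E : ι → ι → Module.End ℂ M} {lam : ι → ℂ} {v : M}

/-- A module generated by a singular vector is generated by the lowering operators. -/
theorem IsMatrixUnitRep.eq_top_of_lowering_stable (hE : IsMatrixUnitRep ω d E)
    (hv : IsSingularVector E lam v) (hc : IsCyclicVector E v) {U : Submodule ℂ M} (hvU : v ∈ U)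
    (hU : ∀ i j, j < i → ∀ u ∈ U, E i j u ∈ U) : U = ⊤ := by
  set 𝒲 : Set (Submodule ℂ M) := {W | v ∈ W ∧ ∀ i j, j < i → ∀ u ∈ W, E i j u ∈ W} with h𝒲
  set W := sInf 𝒲 with hW
  have hvW : v ∈ W := Submodule.mem_sInf.mpr fun p hp ↦ hp.1
  have hlow : ∀ i j, j < i → ∀ u ∈ W, E i j u ∈ W := fun i j hij u hu ↦
    Submodule.mem_sInf.mpr fun p hp ↦ hp.2 i j hij u (Submodule.mem_sInf.mp hu p hp)
  -- `W` is the least lowering-stable subspace containing `v`. Its vectors sent into `W` by every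
  -- matrix unit again form such a subspace, so by minimality they exhaust `W`, which is thus stable
  -- under everything. This replaces the triangular decomposition.
  let W' : Submodule ℂ M := W ⊓ ⨅ i, ⨅ j, W.comap (E i j)
  have hW' : ∀ u, u ∈ W' ↔ u ∈ W ∧ ∀ i j, E i j u ∈ W := fun u ↦ by
    simp only [W', Submodule.mem_inf, Submodule.mem_iInf, Submodule.mem_comap]
  have hle : W ≤ W' := by
    refine sInf_le ⟨(hW' _).mpr ⟨hvW, fun i j ↦ ?_⟩, fun k l hkl u hu ↦ (hW' _).mpr ?_⟩
    · rcases lt_trichotomy i j with h | rfl | h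
      · rw [hv.raise i j h]; exact W.zero_mem
      · rw [hv.diag]; exact W.smul_mem _ hvW
      · exact hlow i j h v hvW
    · obtain ⟨hu, hu'⟩ := (hW' _).mp hu
      refine ⟨hlow k l hkl u hu, fun i j ↦ ?_⟩
      rw [hE.apply_apply]
      refine W.add_mem (W.smul_mem _ (hlow k l hkl _ (hu' i j)))
        (W.sub_mem ?_ (W.smul_mem _ ?_))
      · split_ifs
        exacts [hu' _ _, W.zero_mem]
      · split_ifs
        exacts [hu' _ _, W.zero_mem]
  have htop : W = ⊤ := hc W (fun i j u hu ↦ ((hW' u).mp (hle hu)).2 i j) hvW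
  exact eq_top_iff.mpr (htop ▸ sInf_le ⟨hvU, hU⟩)

theorem exists_strictMono_nat (ι : Type*) [LinearOrder ι] [Fintype ι] :
    ∃ p : ι → ℕ, StrictMono p :=
  ⟨fun i ↦ ((Fintype.orderIsoFinOfCardEq ι rfl).symm i : ℕ), fun _ _ h ↦
    (Fintype.orderIsoFinOfCardEq ι rfl).symm.strictMono h⟩

theorem IsMatrixUnitRep.heightOperator_apply [Fintype ι] (hω : IsCommutativeFactor ω)
    (hE : IsMatrixUnitRep ω d E) (c : ι → ℂ) (k l : ι) (u : M) :
    (∑ i, c i • E i i) (E k l u) = E k l ((∑ i, c i • E i i) u) + (c k - c l) • E k l u := by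
  simp only [LinearMap.sum_apply, LinearMap.smul_apply, hE.diag_apply hω, smul_add,
    Finset.sum_add_distrib, map_sum, map_smul, smul_sub, Finset.sum_sub_distrib, smul_ite,
    smul_zero, Finset.sum_ite_eq, Finset.sum_ite_eq', Finset.mem_univ, if_true, sub_smul]

/-- A singular vector that generates the module has the least value of the height. -/
theorem IsMatrixUnitRep.height_ne [Fintype ι] (hω : IsCommutativeFactor ω)
    (hE : IsMatrixUnitRep ω d E) (hv : IsSingularVector E lam v) (hc : IsCyclicVector E v)
    {p : ι → ℕ} (hp : StrictMono p) {u : M} (hu : u ≠ 0) {μ : ι → ℂ}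
    (hu' : ∀ i, E i i u = μ i • u) {n : ℕ} :
    ∑ i, (p i : ℂ) * lam i ≠ ∑ i, (p i : ℂ) * μ i + (n + 1) := by
  intro hlt
  set H : Module.End ℂ M := ∑ i, (p i : ℂ) • E i i with hH
  set a : ℂ := ∑ i, (p i : ℂ) * lam i with ha
  -- Lowering operators increase the height by a natural number, so this sum of eigenspaces is
  -- everything; `u` would have an eigenvalue outside `a + ℕ`.
  set U : Submodule ℂ M := ⨆ m : ℕ, H.eigenspace (a + m) with hU
  have hHv : H v = a • v := by
    simp [hH, ha, LinearMap.sum_apply, hv.diag, Finset.sum_smul, smul_smul]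
  have hHu : H u = (∑ i, (p i : ℂ) * μ i) • u := by
    simp [hH, LinearMap.sum_apply, hu', Finset.sum_smul, smul_smul]
  have hUtop : U = ⊤ := by
    refine hE.eq_top_of_lowering_stable hv hc ?_ fun k l hkl ↦ ?_
    · refine Submodule.mem_iSup_of_mem 0 ?_
      rw [Module.End.mem_eigenspace_iff, hHv]
      simp
    · have : U ≤ U.comap (E k l) := by
        refine iSup_le fun m x hx ↦ ?_
        rw [Module.End.mem_eigenspace_iff] at hx
        obtain ⟨r, hr⟩ := Nat.exists_eq_add_of_le (hp hkl).le
        refine Submodule.mem_iSup_of_mem (m + r) ?_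
        rw [Module.End.mem_eigenspace_iff, hH, hE.heightOperator_apply hω, ← hH, hx, map_smul,
          ← add_smul, hr]
        push_cast
        congr 1
        ring
      exact this
  have hdis := (Module.End.eigenspaces_iSupIndep H) (∑ i, (p i : ℂ) * μ i)
  refine hu (Submodule.disjoint_def.mp hdis u ?_ ?_)
  · rwa [Module.End.mem_eigenspace_iff]
  · have : (⊤ : Submodule ℂ M) ≤ ⨆ j, ⨆ (_ : j ≠ ∑ i, (p i : ℂ) * μ i), H.eigenspace j := by
      rw [← hUtop]
      refine iSup_le fun m ↦ le_iSup₂_of_le (a + m) (fun h ↦ ?_) le_rfl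
      rw [hlt] at h
      have h1 : ((n + 1 + m : ℕ) : ℂ) = 0 := by
        push_cast
        linear_combination h
      exact absurd (Nat.cast_eq_zero.mp h1) (by omega)
    exact this Submodule.mem_top

end

/-! ### Dominance of the highest weight and finite-dimensionality -/

section

variable {Γ ι M : Type*} [AddCommGroup Γ] {ω : Γ → Γ → ℂˣ} [LinearOrder ι] [AddCommGroup M]
  [Module ℂ M] {d : ι → Γ} {E : ι → ι → Module.End ℂ M} {lam : ι → ℂ} {v : M}

theorem IsMatrixUnitRep.diag_lowering_pow (hω : IsCommutativeFactor ω)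
    (hE : IsMatrixUnitRep ω d E) (hv : IsSingularVector E lam v) {a b : ι} (k : ℕ) (i : ι) :
    E i i ((E b a ^ k) v) =
      (lam i + (if i = b then (k : ℂ) else 0) - (if a = i then (k : ℂ) else 0)) •
        (E b a ^ k) v := by
  induction k with
  | zero => simp [hv.diag]
  | succ k ih =>
    rw [pow_succ', Module.End.mul_apply, hE.diag_apply hω, ih, map_smul]
    split_ifs <;> push_cast <;> module

theorem IsMatrixUnitRep.raise_lower_apply (hω : IsCommutativeFactor ω) (hE : IsMatrixUnitRep ω d E)
    {a b : ι} (heven : ω (d a) (d a) * ω (d b) (d b) = 1) (u : M) :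
    E a b (E b a u) = E b a (E a b u) + (E a a u - E b b u) := by
  have h1 : ω (d a - d b) (d b - d a) = 1 := by
    rw [← neg_sub (d a) (d b), hω.neg_right, hω.sub_sub_self, heven, inv_one]
  rw [hE.apply_apply, h1]
  simp

/-- The classical `sl₂` formula: evenness of the root makes the bracket of `E a b` and `E b a` an
ordinary commutator. -/
theorem IsMatrixUnitRep.raise_lowering_pow (hω : IsCommutativeFactor ω)
    (hE : IsMatrixUnitRep ω d E) (hv : IsSingularVector E lam v) {a b : ι} (hab : a < b)
    (heven : ω (d a) (d a) * ω (d b) (d b) = 1) (k : ℕ) :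
    E a b ((E b a ^ (k + 1)) v) = ((k + 1) * (lam a - lam b - k)) • (E b a ^ k) v := by
  induction k with
  | zero =>
    rw [zero_add, pow_one, hE.raise_lower_apply hω heven, hv.raise a b hab, hv.diag, hv.diag]
    simp [sub_smul]
  | succ k ih =>
    rw [pow_succ' _ (k + 1), Module.End.mul_apply, hE.raise_lower_apply hω heven, ih,
      hE.diag_lowering_pow hω hv, hE.diag_lowering_pow hω hv, map_smul, ← Module.End.mul_apply,
      ← pow_succ', if_neg hab.ne, if_pos rfl, if_pos rfl]
    push_cast
    module

/-- Moving `E i j` past `E b a` can only create `E i a` (when `j = b`) or `E b j` (when `i = a`).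
Since no label lies strictly between `a` and `b`, these are again raising operators other than `E a
b`. -/
theorem IsMatrixUnitRep.raise_lowering_pow_covBy
    (hE : IsMatrixUnitRep ω d E) (hv : IsSingularVector E lam v) {a b : ι} (hab : a ⋖ b)
    (k : ℕ) : ∀ i j, i < j → (i, j) ≠ (a, b) → E i j ((E b a ^ k) v) = 0 := by
  induction k with
  | zero => intro i j hij _; simpa using hv.raise i j hij
  | succ k ih =>
    intro i j hij hne
    rw [pow_succ', Module.End.mul_apply, hE.apply_apply, ih i j hij hne, map_zero, smul_zero,
      zero_add]
    have h1 : (if j = b then E i a ((E b a ^ k) v) else 0) = 0 := by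
      split_ifs with h
      · subst h
        have hia : i ≠ a := fun h ↦ hne (by rw [h])
        exact ih _ _ (lt_of_le_of_ne (hab.le_of_lt hij) hia) (by simp [hab.lt.ne])
      · rfl
    have h2 : (if a = i then E b j ((E b a ^ k) v) else 0) = 0 := by
      split_ifs with h
      · subst h
        have hjb : j ≠ b := fun h ↦ hne (by rw [h])
        exact ih _ _ (lt_of_le_of_ne (hab.ge_of_gt hij) hjb.symm) (by simp [hab.lt.ne'])
      · rfl
    rw [h1, h2, smul_zero, sub_zero]

/-- In a simple highest weight module, the lowering operator of an even simple root acts nilpotently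
on the highest weight vector, if the highest weight is dominant. -/
theorem IsMatrixUnitRep.lowering_pow_eq_zero [Fintype ι] (hω : IsCommutativeFactor ω)
    (hE : IsMatrixUnitRep ω d E) (hv : IsSingularVector E lam v) (hv0 : v ≠ 0) {a b : ι}
    (hab : a ⋖ b)
    (heven : ω (d a) (d a) * ω (d b) (d b) = 1) {n : ℕ} (hn : lam a - lam b = n)
    (hc : (E b a ^ (n + 1)) v ≠ 0 → IsCyclicVector E ((E b a ^ (n + 1)) v)) :
    (E b a ^ (n + 1)) v = 0 := by
  by_contra hne
  obtain ⟨p, hp⟩ := exists_strictMono_nat ι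
  obtain ⟨r, hr⟩ := Nat.exists_eq_add_of_lt (hp hab.lt)
  set μ : ι → ℂ := fun i ↦
    lam i + (if i = b then ((n + 1 : ℕ) : ℂ) else 0) - (if a = i then ((n + 1 : ℕ) : ℂ) else 0)
    with hμ
  have hsing : IsSingularVector E μ ((E b a ^ (n + 1)) v) := by
    refine ⟨fun i j hij ↦ ?_, fun i ↦ hE.diag_lowering_pow hω hv _ i⟩
    by_cases h : (i, j) = (a, b)
    · obtain ⟨rfl, rfl⟩ := Prod.mk.inj h
      rw [hE.raise_lowering_pow hω hv hij heven, hn]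
      simp
    · exact hE.raise_lowering_pow_covBy hv hab _ i j hij h
  -- The new singular vector would generate, yet `v` lies below it by `(n + 1) * (p b - p a)` with
  -- `p b - p a = r + 1`. The `- 1` compensates the `n + 1` in `height_ne`.
  refine hE.height_ne hω hsing (hc hne) hp hv0 hv.diag (n := (n + 1) * (r + 1) - 1) ?_
  have h1 : (((n + 1) * (r + 1) - 1 : ℕ) : ℂ) + 1 = (n + 1) * (r + 1) := by
    rw [← Nat.cast_add_one, Nat.sub_add_cancel (Nat.mul_pos n.succ_pos r.succ_pos)]
    push_cast
    rfl
  rw [h1]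
  simp only [hμ, mul_sub, mul_add, Finset.sum_sub_distrib, Finset.sum_add_distrib, mul_ite,
    mul_zero, Finset.sum_ite_eq, Finset.sum_ite_eq', Finset.mem_univ, if_true, hr]
  push_cast
  ring

theorem IsMatrixUnitRep.locallyNilpotentPart_eq_top
    (hE : IsMatrixUnitRep ω d E) (hc : IsCyclicVector E v) {a b : ι} (hab : a ≠ b)
    (h : ∃ k, (E a b ^ k) v = 0) : locallyNilpotentPart (E a b) = ⊤ :=
  hc _ (fun i j ↦ hE.locallyNilpotentPart_stable hab i j) h

/-- All lowering operators of a simple highest weight module with dominant highest weight are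
locally nilpotent. -/
theorem IsMatrixUnitRep.lowering_locallyNilpotent [Fintype ι] (hω : IsCommutativeFactor ω)
    (hd : ∀ a b, ω (d a) (d a) = 1 → ω (d b) (d b) = -1 → a < b)
    (hE : IsMatrixUnitRep ω d E) (hv : IsSingularVector E lam v) (hv0 : v ≠ 0)
    (hc : ∀ a b k, (E b a ^ k) v ≠ 0 → IsCyclicVector E ((E b a ^ k) v))
    (hlam : ∀ a b, a < b → ω (d a) (d a) * ω (d b) (d b) = 1 → ∃ n : ℕ, lam a - lam b = n)
    (a : ι) : ∀ b, a < b → locallyNilpotentPart (E b a) = ⊤ := by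
  have hcv : IsCyclicVector E v := by
    have := hc a a 0
    simp only [pow_zero, Module.End.one_apply] at this
    exact this hv0
  have hsimple : ∀ a b, a ⋖ b → ω (d a) (d a) * ω (d b) (d b) = 1 →
      locallyNilpotentPart (E b a) = ⊤ := by
    intro a b hab heven
    obtain ⟨n, hn⟩ := hlam a b hab.lt heven
    exact hE.locallyNilpotentPart_eq_top hcv hab.lt.ne'
      ⟨n + 1, hE.lowering_pow_eq_zero hω hv hv0 hab heven hn (hc a b (n + 1))⟩
  intro b
  induction b using WellFoundedLT.induction with
  | ind c ih =>
    intro hac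
    by_cases heven : ω (d a) (d a) * ω (d c) (d c) = 1
    swap
    · rw [eq_top_iff]
      rintro u -
      refine ⟨2, ?_⟩
      rw [pow_two, hE.mul_self_eq_zero hω hac.ne' (by rwa [mul_comm]), LinearMap.zero_apply]
    by_cases hcov : a ⋖ c
    · exact hsimple a c hcov heven
    -- With `b` the label just below `c`, `E c a` is the colour commutator of `E c b`, a simple root
    -- vector, and `E b a`, covered by the induction hypothesis.
    obtain ⟨b, hb, hbc⟩ := exists_le_covBy_of_lt hac
    have hab : a < b := lt_of_le_of_ne hb fun h ↦ hcov (h ▸ hbc)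
    -- Here the distinguished order enters: a label between two labels of equal parity shares their
    -- parity.
    have hbb : ω (d b) (d b) = ω (d c) (d c) := by
      rcases hω.self_eq_one_or (d a) with ha | ha
      · have hc1 : ω (d c) (d c) = 1 := by rwa [ha, one_mul] at heven
        rcases hω.self_eq_one_or (d b) with hb | hb
        · rw [hb, hc1]
        · exact absurd (hd c b hc1 hb) (not_lt.mpr hbc.lt.le)
      · have hc1 : ω (d c) (d c) = -1 := by
          rw [ha, neg_one_mul] at heven
          rw [← heven, neg_neg]
        rcases hω.self_eq_one_or (d b) with hb | hb
        · exact absurd (hd b a hb ha) (not_lt.mpr hab.le)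
        · rw [hb, hc1]
    have hcc := hω.self_mul_self (d c)
    have h1 := ih b hbc.lt hab
    have h2 := hsimple b c hbc (by rw [hbb, hcc])
    have hr1 := hE c b b a
    rw [if_pos rfl, if_neg hac.ne, smul_zero, sub_zero] at hr1
    have hr2 := hE c b c a
    rw [if_neg hbc.lt.ne, if_neg hac.ne, smul_zero, sub_zero, sub_eq_zero] at hr2
    have hr3 := hE c a b a
    rw [if_neg hab.ne, if_neg hac.ne, smul_zero, sub_zero, sub_eq_zero] at hr3
    -- The Heisenberg lemma needs the same factor in both relations; they differ by the self-factor
    -- of the degree `d b - d a`, which is `1` as that root is even.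
    have hca : ω (d c - d a) (d b - d a) = ω (d c - d b) (d b - d a) := by
      have : d c - d a = (d c - d b) + (d b - d a) := by abel
      rw [this, hω.map_add_left, hω.sub_sub_self, hbb, mul_comm (ω (d c) (d c)), heven, mul_one]
    rw [hca] at hr3
    exact locallyNilpotentPart_commutator (Units.ne_zero _) hr1 hr2 hr3 h2 h1

/-- The lowering operators are adjoined row by row, from the largest row index down. Bracketing an
operator of a larger row with `E a b` gives zero or an operator of that larger row, and operators of
one row colour commute. So each new operator normalizes the span of the earlier ones, and saturation
keeps dimensions finite. -/
theorem IsMatrixUnitRep.exists_finiteDimensional_lowering_stable [Fintype ι]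
    (hE : IsMatrixUnitRep ω d E)
    (hT : ∀ a b, a < b → locallyNilpotentPart (E b a) = ⊤) (v : M) :
    ∃ U : Submodule ℂ M, FiniteDimensional ℂ U ∧ v ∈ U ∧
      ∀ i j, j < i → ∀ u ∈ U, E i j u ∈ U := by
  suffices h : ∀ s : Finset ι, ∃ U : Submodule ℂ M, FiniteDimensional ℂ U ∧ v ∈ U ∧
      ∀ i ∈ s, ∀ j, j < i → ∀ u ∈ U, E i j u ∈ U by
    obtain ⟨U, h1, h2, h3⟩ := h Finset.univ
    exact ⟨U, h1, h2, fun i ↦ h3 i (Finset.mem_univ i)⟩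
  intro s
  induction s using Finset.induction_on_min with
  | empty => exact ⟨Submodule.span ℂ {v}, inferInstance, Submodule.mem_span_singleton_self v, by simp⟩
  | insert a s has ih =>
    suffices h : ∀ t : Finset ι, (∀ b ∈ t, b < a) → ∃ U : Submodule ℂ M,
        FiniteDimensional ℂ U ∧ v ∈ U ∧ (∀ i ∈ s, ∀ j, j < i → ∀ u ∈ U, E i j u ∈ U) ∧
        ∀ b ∈ t, ∀ u ∈ U, E a b u ∈ U by
      obtain ⟨U, h1, h2, h3, h4⟩ := h (Finset.univ.filter (· < a)) (by simp)
      refine ⟨U, h1, h2, fun i hi j hj ↦ ?_⟩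
      rcases Finset.mem_insert.mp hi with rfl | hi
      · exact h4 j (by simpa using hj)
      · exact h3 i hi j hj
    intro t ht
    induction t using Finset.induction_on with
    | empty =>
      obtain ⟨U, h1, h2, h3⟩ := ih
      exact ⟨U, h1, h2, h3, by simp⟩
    | insert b t _ iht =>
      obtain ⟨U, h1, h2, h3, h4⟩ := iht fun b' hb' ↦ ht b' (Finset.mem_insert_of_mem hb')
      have hba : b < a := ht b (Finset.mem_insert_self b t)
      let S : Set (Module.End ℂ M) :=
        {X | (∃ i ∈ s, ∃ j, j < i ∧ X = E i j) ∨ ∃ b' ∈ t, X = E a b'}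
      obtain ⟨U', g1, g2, g3, g4⟩ := exists_finiteDimensional_stable_insert (hT b a hba) S (U := U)
        (by
          rintro X (⟨i, hi, j, hj, rfl⟩ | ⟨b', hb', rfl⟩)
          · exact h3 i hi j hj
          · exact h4 b' hb')
        (by
          rintro X (⟨i, hi, j, hj, rfl⟩ | ⟨b', hb', rfl⟩)
          · have hai := has i hi
            refine ⟨(ω (d i - d j) (d a - d b) : ℂ), ?_⟩
            rw [hE i j a b, if_neg (hba.trans hai).ne, smul_zero, sub_zero]
            split_ifs with h
            · exact Submodule.subset_span (Or.inl ⟨i, hi, b, hba.trans hai, rfl⟩)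
            · exact Submodule.zero_mem _
          · refine ⟨(ω (d a - d b') (d a - d b) : ℂ), ?_⟩
            rw [hE a b' a b, if_neg hba.ne, if_neg (ht b' (Finset.mem_insert_of_mem hb')).ne, smul_zero,
              sub_zero]
            exact Submodule.zero_mem _)
      refine ⟨U', g1, g2 h2, fun i hi j hj ↦ g3 _ (Or.inl ⟨i, hi, j, hj, rfl⟩), fun b' hb' ↦ ?_⟩
      rcases Finset.mem_insert.mp hb' with rfl | hb'
      · exact g4
      · exact g3 _ (Or.inr ⟨b', hb', rfl⟩)

/-- A simple highest weight module with dominant highest weight is finite-dimensional. -/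
theorem IsMatrixUnitRep.finiteDimensional_of_dominant [Fintype ι] (hω : IsCommutativeFactor ω)
    (hd : ∀ a b, ω (d a) (d a) = 1 → ω (d b) (d b) = -1 → a < b)
    (hE : IsMatrixUnitRep ω d E) (hv : IsSingularVector E lam v) (hv0 : v ≠ 0)
    (hcv : IsCyclicVector E v)
    (hc : ∀ a b k, (E b a ^ k) v ≠ 0 → IsCyclicVector E ((E b a ^ k) v))
    (hlam : ∀ a b, a < b → ω (d a) (d a) * ω (d b) (d b) = 1 → ∃ n : ℕ, lam a - lam b = n) :
    FiniteDimensional ℂ M := by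
  obtain ⟨U, h1, h2, h3⟩ := hE.exists_finiteDimensional_lowering_stable
    (hE.lowering_locallyNilpotent hω hd hv hv0 hc hlam) v
  rw [hE.eq_top_of_lowering_stable hv hcv h2 h3] at h1
  exact Module.finite_def.mpr ((Submodule.fg_iff_finiteDimensional _).mpr h1)

/-- The highest weight of a finite-dimensional module is dominant. -/
theorem IsMatrixUnitRep.exists_nat_of_finiteDimensional (hω : IsCommutativeFactor ω)
    (hE : IsMatrixUnitRep ω d E) [FiniteDimensional ℂ M] (hv : IsSingularVector E lam v)
    (hv0 : v ≠ 0) {a b : ι} (hab : a < b) (heven : ω (d a) (d a) * ω (d b) (d b) = 1) :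
    ∃ n : ℕ, lam a - lam b = n := by
  have hzero : ∃ k, (E b a ^ k) v = 0 := by
    by_contra! hne
    -- If no power killed `v`, these would be eigenvectors of `E a a` for infinitely many distinct
    -- eigenvalues.
    have hli : LinearIndependent ℂ fun k : ℕ ↦ (E b a ^ k) v := by
      refine Module.End.eigenvectors_linearIndependent' (E a a) (fun k : ℕ ↦ lam a - k)
        (fun k l hkl ↦ by simpa using hkl) _ fun k ↦ ?_
      rw [Module.End.hasEigenvector_iff, Module.End.mem_eigenspace_iff]
      refine ⟨?_, hne k⟩
      rw [hE.diag_lowering_pow hω hv, if_neg hab.ne, if_pos rfl, add_zero]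
    exact Set.infinite_univ (Set.finite_univ_iff.mpr hli.finite)
  obtain ⟨k, hk, hk'⟩ := Nat.exists_not_and_succ_of_not_zero_of_exists
    (p := fun k ↦ (E b a ^ k) v = 0) (by simpa using hv0) hzero
  have h := hE.raise_lowering_pow hω hv hab heven k
  rw [hk', map_zero, eq_comm, smul_eq_zero_iff_left hk, mul_eq_zero, sub_eq_zero] at h
  exact ⟨k, h.resolve_left (Nat.cast_add_one_ne_zero k)⟩

end

/-! ### Gradings and projections -/

section Gradings

variable {Γ M : Type*} [DecidableEq Γ] [AddCommGroup M] [Module ℂ M] {𝓜 : Γ → Submodule ℂ M}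

/-- With the projections as linear endomorphisms, being graded becomes stability under operators,
and gradings pass easily to submodules and quotients. -/
theorem exists_projections (h : DirectSum.IsInternal 𝓜) :
    ∃ π : Γ → Module.End ℂ M, (∀ γ, ∀ u ∈ 𝓜 γ, π γ u = u) ∧
      (∀ γ δ, γ ≠ δ → ∀ u ∈ 𝓜 δ, π γ u = 0) ∧ ∀ γ u, π γ u ∈ 𝓜 γ := by
  let := h.chooseDecomposition
  refine ⟨fun γ ↦ (𝓜 γ).subtype ∘ₗ DirectSum.component ℂ Γ (fun i ↦ 𝓜 i) γ ∘ₗ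
    (DirectSum.decomposeLinearEquiv 𝓜).toLinearMap, ?_, ?_, ?_⟩
  · intro γ u hu
    exact DirectSum.decompose_of_mem_same 𝓜 hu
  · intro γ δ hγδ u hu
    exact DirectSum.decompose_of_mem_ne 𝓜 hu hγδ.symm
  · intro γ u
    exact ((DirectSum.decompose 𝓜 u) γ).2

theorem isInternal_of_projections (htop : ⨆ γ, 𝓜 γ = ⊤) (π : Γ → Module.End ℂ M)
    (h1 : ∀ γ, ∀ u ∈ 𝓜 γ, π γ u = u) (h2 : ∀ γ δ, γ ≠ δ → ∀ u ∈ 𝓜 δ, π γ u = 0) :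
    DirectSum.IsInternal 𝓜 := by
  refine DirectSum.isInternal_submodule_of_iSupIndep_of_iSup_eq_top (fun γ ↦ ?_) htop
  rw [Submodule.disjoint_def]
  intro u hu hu'
  rw [← h1 γ u hu]
  have : ⨆ (δ) (_ : δ ≠ γ), 𝓜 δ ≤ LinearMap.ker (π γ) :=
    iSup₂_le fun δ hδ w hw ↦ h2 γ δ hδ.symm w hw
  exact this hu'

theorem isGradedSubspace_iff {π : Γ → Module.End ℂ M} (htop : ⨆ γ, 𝓜 γ = ⊤)
    (h1 : ∀ γ, ∀ u ∈ 𝓜 γ, π γ u = u)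
    (h2 : ∀ γ δ, γ ≠ δ → ∀ u ∈ 𝓜 δ, π γ u = 0) (h3 : ∀ γ u, π γ u ∈ 𝓜 γ) {W : Submodule ℂ M} :
    IsGradedSubspace 𝓜 W ↔ ∀ γ, ∀ u ∈ W, π γ u ∈ W := by
  constructor
  · intro hW γ u hu
    have : ⨆ δ, W ⊓ 𝓜 δ ≤ W.comap (π γ) := by
      refine iSup_le fun δ w hw ↦ ?_
      rw [Submodule.mem_comap]
      by_cases hγδ : γ = δ
      · subst hγδ; rw [h1 γ w hw.2]; exact hw.1
      · rw [h2 γ δ hγδ w hw.2]; exact W.zero_mem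
    exact this (hW.le hu)
  · intro hW
    refine le_antisymm (fun u hu ↦ ?_) (iSup_le fun γ ↦ inf_le_left)
    have key : ∀ u : M, u ∈ Submodule.span ℂ (Set.range fun γ ↦ π γ u) := by
      intro u
      have hu : u ∈ ⨆ γ, 𝓜 γ := htop ▸ Submodule.mem_top
      obtain ⟨f, hf⟩ := (Submodule.mem_iSup_iff_exists_finsupp _ _).mp hu
      have hπ : ∀ γ, π γ u = f γ := by
        intro γ
        rw [← hf.2, Finsupp.sum, map_sum]
        by_cases hγ : γ ∈ f.support
        · rw [Finset.sum_eq_single γ, h1 γ _ (hf.1 γ)]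
          · exact fun δ _ hδ ↦ h2 γ δ hδ.symm _ (hf.1 δ)
          · exact fun h ↦ absurd hγ h
        · rw [Finsupp.notMem_support_iff.mp hγ]
          refine Finset.sum_eq_zero fun δ hδ ↦ h2 γ δ (fun h ↦ hγ (h ▸ hδ)) _ (hf.1 δ)
      rw [← hf.2]
      refine Submodule.sum_mem _ fun γ _ ↦ Submodule.subset_span ⟨γ, ?_⟩
      simp only [hf.2, hπ]
    have : Submodule.span ℂ (Set.range fun γ ↦ π γ u) ≤ ⨆ γ, W ⊓ 𝓜 γ := by
      rw [Submodule.span_le]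
      rintro _ ⟨γ, rfl⟩
      exact Submodule.mem_iSup_of_mem γ ⟨hW γ u hu, h3 γ u⟩
    exact this (key u)

end Gradings

/-! ### Matrix units of a homogeneous basis -/

section MatrixUnits

variable {V ι : Type*} [AddCommGroup V] [Module ℂ V] (e : Module.Basis ι ℂ V)

theorem matrixUnit_apply (a b : ι) (v : V) : matrixUnit e a b v = e.repr v b • e a := rfl

theorem matrixUnit_basis [DecidableEq ι] (a b c : ι) :
    matrixUnit e a b (e c) = if b = c then e a else 0 := by
  rw [matrixUnit_apply, e.repr_self, Finsupp.single_apply]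
  by_cases h : b = c
  · simp [h]
  · simp [h, Ne.symm h]

theorem matrixUnit_mul [DecidableEq ι] (a b c k : ι) :
    matrixUnit e a b * matrixUnit e c k = if b = c then matrixUnit e a k else 0 := by
  refine e.ext fun x ↦ ?_
  rw [Module.End.mul_apply, matrixUnit_basis]
  split_ifs with h1 h2 <;> simp_all [matrixUnit_basis]

theorem eq_sum_matrixUnit [Fintype ι] (X : Module.End ℂ V) :
    X = ∑ a, ∑ b, e.repr (X (e b)) a • matrixUnit e a b := by
  classical
  refine e.ext fun c ↦ ?_
  simp only [LinearMap.sum_apply, LinearMap.smul_apply, matrixUnit_basis, smul_ite, smul_zero,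
    Finset.sum_ite_eq', Finset.mem_univ, if_true]
  exact (e.sum_repr _).symm

theorem isStable_iff [Fintype ι] {L : Type*} [AddCommGroup L] [Module ℂ L]
    (ρ : Module.End ℂ V →ₗ[ℂ] Module.End ℂ L) (W : Submodule ℂ L) :
    IsStable ρ W ↔ ∀ a b, ∀ u ∈ W, ρ (matrixUnit e a b) u ∈ W := by
  refine ⟨fun h a b u hu ↦ h _ u hu, fun h X u hu ↦ ?_⟩
  rw [eq_sum_matrixUnit e X]
  simp only [map_sum, map_smul, LinearMap.sum_apply, LinearMap.smul_apply]
  exact W.sum_mem fun a _ ↦ W.sum_mem fun b _ ↦ W.smul_mem _ (h a b u hu)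

theorem eps_cartanUnit [DecidableEq ι] (a b : ι) :
    eps e a (cartanUnit e b) = if a = b then 1 else 0 := by
  change e.repr (matrixUnit e b b (e a)) a = _
  rw [matrixUnit_basis]
  by_cases h : b = a
  · simp [h]
  · simp [h, Ne.symm h]

theorem isHighestWeightVector_iff [LT ι] {Γ : Type*} {L : Type*} [AddCommGroup L] [Module ℂ L]
    (lam : Module.Dual ℂ (cartan e)) (𝓛 : Γ → Submodule ℂ L)
    (ρ : Module.End ℂ V →ₗ[ℂ] Module.End ℂ L) (v : L) :
    IsHighestWeightVector e lam 𝓛 ρ v ↔ v ≠ 0 ∧ (∃ γ, v ∈ 𝓛 γ) ∧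
      IsSingularVector (fun a b ↦ ρ (matrixUnit e a b)) (fun a ↦ lam (cartanUnit e a)) v := by
  constructor
  · intro h
    exact ⟨h.ne_zero, h.homogeneous, fun a b hab ↦
      h.nilradical_smul _ (Submodule.subset_span ⟨a, b, hab, rfl⟩), fun a ↦
      h.cartan_smul (cartanUnit e a)⟩
  · rintro ⟨h1, h2, h3⟩
    refine ⟨h1, h2, fun X hX ↦ ?_, fun ⟨h, hh⟩ ↦ ?_⟩
    · induction hX using Submodule.span_induction with
      | mem X hX => obtain ⟨a, b, hab, rfl⟩ := hX; exact h3.raise a b hab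
      | zero => simp
      | add X Y _ _ hX hY => rw [map_add, LinearMap.add_apply, hX, hY, add_zero]
      | smul c X _ hX => rw [map_smul, LinearMap.smul_apply, hX, smul_zero]
    · induction hh using Submodule.span_induction with
      | mem X hX => obtain ⟨a, rfl⟩ := hX; exact h3.diag a
      | zero =>
        have : lam ⟨0, (cartan e).zero_mem⟩ = 0 := lam.map_zero
        simp [this]
      | add X Y hX' hY' hX hY =>
        have : lam ⟨X + Y, (cartan e).add_mem hX' hY'⟩ = lam ⟨X, hX'⟩ + lam ⟨Y, hY'⟩ :=
          lam.map_add ⟨X, hX'⟩ ⟨Y, hY'⟩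
        rw [this, add_smul, ← hX, ← hY]
        simp
      | smul c X hX' hX =>
        have : lam ⟨c • X, (cartan e).smul_mem c hX'⟩ = c • lam ⟨X, hX'⟩ :=
          lam.map_smul c ⟨X, hX'⟩
        rw [this, smul_assoc, ← hX]
        simp

theorem isHighestWeightModule_iff [Fintype ι] [LT ι] {Γ : Type*} {L : Type*} [AddCommGroup L]
    [Module ℂ L] (lam : Module.Dual ℂ (cartan e)) (𝓛 : Γ → Submodule ℂ L)
    (ρ : Module.End ℂ V →ₗ[ℂ] Module.End ℂ L) :
    IsHighestWeightModule e lam 𝓛 ρ ↔ ∃ v, v ≠ 0 ∧ (∃ γ, v ∈ 𝓛 γ) ∧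
      IsSingularVector (fun a b ↦ ρ (matrixUnit e a b)) (fun a ↦ lam (cartanUnit e a)) v ∧
      IsCyclicVector (fun a b ↦ ρ (matrixUnit e a b)) v := by
  simp only [IsHighestWeightModule, isHighestWeightVector_iff, isStable_iff e, IsCyclicVector,
    and_assoc]

/-- For an even root the two labels have the same sign `ω_a`, so `(Υ, Υ) = 2 ω_a` and `(lam, Υ)` is
`ω_a` times the difference of the two entries; the sign cancels. -/
theorem mem_dominantWeights_iff [Fintype ι] [LinearOrder ι] {Γ : Type*} [AddCommGroup Γ]
    {ω : Γ → Γ → ℂˣ} (hω : IsCommutativeFactor ω) (d : ι → Γ)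
    (lam : Module.Dual ℂ (cartan e)) :
    lam ∈ dominantWeights ω e d ↔ ∀ a b, a < b → ω (d a) (d a) * ω (d b) (d b) = 1 →
      ∃ n : ℕ, lam (cartanUnit e a) - lam (cartanUnit e b) = n := by
  have hform : ∀ (μ : Module.Dual ℂ (cartan e)) (a b : ι),
      weightForm ω e d μ (eps e a - eps e b) =
        ω (d a) (d a) * μ (cartanUnit e a) - ω (d b) (d b) * μ (cartanUnit e b) := by
    intro μ a b
    rw [weightForm, finsum_eq_sum_of_fintype]
    simp [eps_cartanUnit, mul_sub, Finset.sum_sub_distrib]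
  have hquot : ∀ a b, a < b → ω (d a) (d a) * ω (d b) (d b) = 1 →
      2 * weightForm ω e d lam (eps e a - eps e b) /
        weightForm ω e d (eps e a - eps e b) (eps e a - eps e b) =
        lam (cartanUnit e a) - lam (cartanUnit e b) := by
    intro a b hab heven
    have hba : ω (d b) (d b) = ω (d a) (d a) := by
      rw [← mul_one (ω (d b) (d b)), ← hω.self_mul_self (d a), mul_left_comm,
        mul_comm (ω (d b) (d b)), heven, mul_one]
    have h0 : (ω (d a) (d a) : ℂ) ≠ 0 := Units.ne_zero _
    rw [hform, hform, hba]
    simp only [LinearMap.sub_apply, eps_cartanUnit, if_true, if_neg hab.ne, if_neg hab.ne']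
    field_simp
    ring
  constructor
  · intro h a b hab heven
    obtain ⟨n, hn⟩ := h _ ⟨a, b, hab, heven, rfl⟩
    exact ⟨n, by rw [← hn, hquot a b hab heven]⟩
  · rintro h _ ⟨a, b, hab, heven, rfl⟩
    obtain ⟨n, hn⟩ := h a b hab heven
    exact ⟨n, by rw [← hn, hquot a b hab heven]⟩

theorem repr_eq_zero_of_mem {Γ : Type*} [DecidableEq Γ] {𝒱 : Γ → Submodule ℂ V}
    {e : Module.Basis ι ℂ V} {d : ι → Γ} (hV : DirectSum.IsInternal 𝒱) (he : ∀ i, e i ∈ 𝒱 (d i)) {γ : Γ}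
    {v : V} (hv : v ∈ 𝒱 γ) {b : ι} (hb : d b ≠ γ) : e.repr v b = 0 := by
  classical
  obtain ⟨π, h1, h2, -⟩ := exists_projections hV
  have h : e.coord b ∘ₗ π γ = 0 := by
    refine e.ext fun c ↦ ?_
    by_cases hc : d c = γ
    · have hcb : c ≠ b := fun h ↦ hb (h ▸ hc)
      have := h1 γ (e c) (hc ▸ he c)
      simp [this, hcb]
    · simp [h2 γ (d c) (Ne.symm hc) (e c) (he c)]
  have := congrArg (fun f ↦ f v) h
  simpa [h1 γ v hv] using this

end MatrixUnits

/-! ### Graded modules in terms of matrix units, and homogeneous singular vectors -/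

section GradedModules

variable {Γ V ι : Type*} [AddCommGroup Γ] [DecidableEq Γ] [AddCommGroup V] [Module ℂ V]
  {𝒱 : Γ → Submodule ℂ V} {e : Module.Basis ι ℂ V} {d : ι → Γ} {ω : Γ → Γ → ℂˣ}

theorem matrixUnit_mem_glDeg (hV : DirectSum.IsInternal 𝒱) (he : ∀ i, e i ∈ 𝒱 (d i)) (a b : ι) :
    matrixUnit e a b ∈ glDeg 𝒱 (d a - d b) := by
  intro γ v hv
  rw [matrixUnit_apply]
  by_cases h : d b = γ
  · rw [h, sub_add_cancel]
    exact Submodule.smul_mem _ _ (he a)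
  · rw [repr_eq_zero_of_mem hV he hv h, zero_smul]
    exact Submodule.zero_mem _

theorem glDeg_le_span [Fintype ι] (hV : DirectSum.IsInternal 𝒱) (he : ∀ i, e i ∈ 𝒱 (d i))
    (α : Γ) : glDeg 𝒱 α ≤
      Submodule.span ℂ {X | ∃ a b, d a - d b = α ∧ X = matrixUnit e a b} := by
  intro X hX
  rw [eq_sum_matrixUnit e X]
  refine Submodule.sum_mem _ fun a _ ↦ Submodule.sum_mem _ fun b _ ↦ ?_
  by_cases h : d a = α + d b
  · exact Submodule.smul_mem _ _ (Submodule.subset_span ⟨a, b, by rw [h, add_sub_cancel_right],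
      rfl⟩)
  · rw [repr_eq_zero_of_mem hV he (hX _ _ (he b)) h, zero_smul]
    exact Submodule.zero_mem _

theorem IsGradedGlModule.isMatrixUnitRep [DecidableEq ι] {L : Type*} [AddCommGroup L] [Module ℂ L]
    {𝓛 : Γ → Submodule ℂ L} {ρ : Module.End ℂ V →ₗ[ℂ] Module.End ℂ L}
    (hV : DirectSum.IsInternal 𝒱) (he : ∀ i, e i ∈ 𝒱 (d i)) (h : IsGradedGlModule ω 𝒱 𝓛 ρ) :
    IsMatrixUnitRep ω d fun a b ↦ ρ (matrixUnit e a b) := by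
  intro i j k l
  dsimp only
  rw [h.map_bracket _ _ _ (matrixUnit_mem_glDeg hV he i j) _ (matrixUnit_mem_glDeg hV he k l),
    glBracket, matrixUnit_mul, matrixUnit_mul, map_sub, map_smul, apply_ite ρ, apply_ite ρ,
    map_zero]

/-- The linear map `gl(V) → End(M)` that sends the matrix unit `E_{ab}` to `E a b`. -/
def ofMatrixUnits [Fintype ι] (e : Module.Basis ι ℂ V) {M : Type*} [AddCommGroup M] [Module ℂ M]
    (E : ι → ι → Module.End ℂ M) : Module.End ℂ V →ₗ[ℂ] Module.End ℂ M :=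
  ∑ a, ∑ b, ((e.coord a).comp (LinearMap.applyₗ (e b))).smulRight (E a b)

theorem ofMatrixUnits_matrixUnit [Fintype ι] {M : Type*} [AddCommGroup M]
    [Module ℂ M] (E : ι → ι → Module.End ℂ M) (a b : ι) :
    ofMatrixUnits e E (matrixUnit e a b) = E a b := by
  classical
  simp only [ofMatrixUnits, LinearMap.sum_apply, LinearMap.smulRight_apply, LinearMap.comp_apply,
    LinearMap.applyₗ_apply_apply, matrixUnit_basis, Module.Basis.coord_apply]
  rw [Finset.sum_eq_single a, Finset.sum_eq_single b]
  · simp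
  · intro c _ hc
    simp [hc.symm]
  · simp
  · intro c _ hc
    refine Finset.sum_eq_zero fun k _ ↦ ?_
    split_ifs
    · simp [hc.symm]
    · simp
  · simp

theorem isGradedGlModule_ofMatrixUnits [Fintype ι] [DecidableEq ι] {M : Type*} [AddCommGroup M]
    [Module ℂ M] {𝓜 : Γ → Submodule ℂ M} {E : ι → ι → Module.End ℂ M}
    (hV : DirectSum.IsInternal 𝒱) (he : ∀ i, e i ∈ 𝒱 (d i))
    (hM : DirectSum.IsInternal 𝓜) (hE : IsMatrixUnitRep ω d E)
    (hdeg : ∀ a b γ, ∀ u ∈ 𝓜 γ, E a b u ∈ 𝓜 (d a - d b + γ)) :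
    IsGradedGlModule ω 𝒱 𝓜 (ofMatrixUnits e E) := by
  refine ⟨hM, ?_, ?_⟩
  · intro α γ X hX u hu
    replace hX := glDeg_le_span hV he α hX
    induction hX using Submodule.span_induction with
    | mem X h =>
      obtain ⟨a, b, rfl, rfl⟩ := h
      rw [ofMatrixUnits_matrixUnit]
      exact hdeg a b γ u hu
    | zero => simp
    | add X Y _ _ hX hY =>
      rw [map_add, LinearMap.add_apply]
      exact Submodule.add_mem _ hX hY
    | smul c X _ hX =>
      rw [map_smul, LinearMap.smul_apply]
      exact Submodule.smul_mem _ _ hX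
  · intro α β X hX Y hY
    replace hX := glDeg_le_span hV he α hX
    replace hY := glDeg_le_span hV he β hY
    unfold glBracket
    induction hX using Submodule.span_induction with
    | mem X h =>
      obtain ⟨a, b, rfl, rfl⟩ := h
      induction hY using Submodule.span_induction with
      | mem Y h =>
        obtain ⟨k, l, rfl, rfl⟩ := h
        rw [matrixUnit_mul, matrixUnit_mul, map_sub, map_smul, apply_ite (ofMatrixUnits e E),
          apply_ite (ofMatrixUnits e E), map_zero]
        simp only [ofMatrixUnits_matrixUnit]
        exact hE a b k l
      | zero => simp
      | add Y Z _ _ hY hZ =>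
        simp only [map_add, map_sub, map_smul, mul_add, add_mul, smul_add] at hY hZ ⊢
        rw [add_sub_add_comm, hY, hZ]
        abel
      | smul c Y _ hY =>
        simp only [map_sub, map_smul, mul_smul_comm, smul_mul_assoc, smul_comm _ c,
          ← smul_sub c] at hY ⊢
        rw [hY]
    | zero => simp
    | add Y Z _ _ hY hZ =>
      simp only [map_add, map_sub, map_smul, mul_add, add_mul, smul_add] at hY hZ ⊢
      rw [add_sub_add_comm, hY, hZ]
      abel
    | smul c Y _ hY =>
      simp only [map_sub, map_smul, mul_smul_comm, smul_mul_assoc, smul_comm _ c,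
        ← smul_sub c] at hY ⊢
      rw [hY]

/-- A stable `W` need not be graded, so simplicity is applied to its graded core `⨆ δ, W ⊓ 𝓛 δ`,
which is stable and still contains the homogeneous vector `v`. -/
theorem IsSimpleGlModule.isCyclicVector [Fintype ι] {L : Type*} [AddCommGroup L] [Module ℂ L]
    {𝓛 : Γ → Submodule ℂ L} {ρ : Module.End ℂ V →ₗ[ℂ] Module.End ℂ L}
    (hV : DirectSum.IsInternal 𝒱) (he : ∀ i, e i ∈ 𝒱 (d i)) (h : IsSimpleGlModule ω 𝒱 𝓛 ρ)
    {v : L} (hv : v ≠ 0) {γ : Γ} (hγ : v ∈ 𝓛 γ) :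
    IsCyclicVector (fun a b ↦ ρ (matrixUnit e a b)) v := by
  intro W hW hvW
  set W' : Submodule ℂ L := ⨆ δ, W ⊓ 𝓛 δ with hW'
  have hle : W' ≤ W := iSup_le fun δ ↦ inf_le_left
  have hvW' : v ∈ W' := Submodule.mem_iSup_of_mem γ ⟨hvW, hγ⟩
  have hst : IsStable ρ W' := by
    rw [isStable_iff e]
    intro a b
    have : W' ≤ W'.comap (ρ (matrixUnit e a b)) := iSup_le fun δ u hu ↦
      Submodule.mem_iSup_of_mem (d a - d b + δ)
        ⟨hW a b u hu.1, h.map_mem _ _ _ (matrixUnit_mem_glDeg hV he a b) u hu.2⟩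
    exact this
  have hgr : IsGradedSubspace 𝓛 W' :=
    le_antisymm (iSup_le fun δ ↦ le_iSup_of_le δ
      (le_inf (le_iSup (fun δ ↦ W ⊓ 𝓛 δ) δ) inf_le_right)) (iSup_le fun δ ↦ inf_le_left)
  rcases h.eq_bot_or_eq_top W' hst hgr with h0 | h1
  · exact absurd (by simpa [h0] using hvW') hv
  · exact eq_top_iff.mpr (h1 ▸ hle)

/-- The start subspace `W` serves to obtain a homogeneous eigenvector, by taking `W` to be a graded
component. The induction carries a stable subspace on which the treated operators are scalar. -/
theorem exists_common_eigenvector {M κ : Type*} [AddCommGroup M] [Module ℂ M]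
    [FiniteDimensional ℂ M] (A : κ → Module.End ℂ M) (hA : ∀ i j u, A i (A j u) = A j (A i u))
    {W : Submodule ℂ M} (hW : W ≠ ⊥) (hAW : ∀ i, ∀ u ∈ W, A i u ∈ W) (s : Finset κ) :
    ∃ u ∈ W, u ≠ 0 ∧ ∀ i ∈ s, ∃ c : ℂ, A i u = c • u := by
  classical
  suffices h : ∃ W' ≤ W, W' ≠ ⊥ ∧ (∀ i, ∀ u ∈ W', A i u ∈ W') ∧
      ∀ i ∈ s, ∃ c : ℂ, ∀ u ∈ W', A i u = c • u by
    obtain ⟨W', h1, h2, -, h4⟩ := h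
    obtain ⟨u, hu, hu0⟩ := W'.ne_bot_iff.mp h2
    exact ⟨u, h1 hu, hu0, fun i hi ↦ (h4 i hi).imp fun c hc ↦ hc u hu⟩
  induction s using Finset.induction_on with
  | empty => exact ⟨W, le_rfl, hW, hAW, by simp⟩
  | insert i s _ ih =>
    obtain ⟨W', h1, h2, h3, h4⟩ := ih
    have : Nontrivial W' := (Submodule.nontrivial_iff_ne_bot).mpr h2
    obtain ⟨c, hc⟩ := Module.End.exists_eigenvalue ((A i).restrict (h3 i))
    obtain ⟨w, hw, hw0⟩ := hc.exists_hasEigenvector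
    rw [Module.End.mem_eigenspace_iff] at hw
    have hw' : A i w = c • (w : M) := congrArg Subtype.val hw
    refine ⟨W' ⊓ (A i).eigenspace c, inf_le_left.trans h1, ?_, fun j u hu ↦ ⟨h3 j u hu.1, ?_⟩,
      fun j hj ↦ ?_⟩
    · refine (Submodule.ne_bot_iff _).mpr ⟨w, ⟨w.2, ?_⟩, by simpa using hw0⟩
      simpa [Module.End.mem_eigenspace_iff] using hw'
    · have hu2 : A i u = c • u := by simpa [Module.End.mem_eigenspace_iff] using hu.2
      change A j u ∈ (A i).eigenspace c
      rw [Module.End.mem_eigenspace_iff, hA, hu2, map_smul]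
    · rcases Finset.mem_insert.mp hj with rfl | hj
      · exact ⟨c, fun u hu ↦ by simpa [Module.End.mem_eigenspace_iff] using hu.2⟩
      · obtain ⟨c', hc'⟩ := h4 j hj
        exact ⟨c', fun u hu ↦ hc' u hu.1⟩

/-- A nonzero finite-dimensional graded module has a homogeneous singular vector. -/
theorem exists_isSingularVector [Fintype ι] [LinearOrder ι] (hω : IsCommutativeFactor ω)
    {M : Type*} [AddCommGroup M] [Module ℂ M] [FiniteDimensional ℂ M] [Nontrivial M]
    {𝓜 : Γ → Submodule ℂ M} {E : ι → ι → Module.End ℂ M}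
    (hM : DirectSum.IsInternal 𝓜) (hE : IsMatrixUnitRep ω d E)
    (hdeg : ∀ a b γ, ∀ u ∈ 𝓜 γ, E a b u ∈ 𝓜 (d a - d b + γ)) :
    ∃ (μ : ι → ℂ) (v : M), v ≠ 0 ∧ (∃ γ, v ∈ 𝓜 γ) ∧ IsSingularVector E μ v := by
  obtain ⟨p, hp⟩ := exists_strictMono_nat ι
  set H : Module.End ℂ M := ∑ i, (p i : ℂ) • E i i with hH
  let S : Set ℂ := {a | ∃ (μ : ι → ℂ) (v : M), v ≠ 0 ∧ (∃ γ, v ∈ 𝓜 γ) ∧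
    (∀ i, E i i v = μ i • v) ∧ H v = a • v}
  have hHv : ∀ (μ : ι → ℂ) v, (∀ i, E i i v = μ i • v) → H v = (∑ i, (p i : ℂ) * μ i) • v := by
    intro μ v hv
    simp [hH, LinearMap.sum_apply, hv, Finset.sum_smul, smul_smul]
  have hfin : S.Finite := by
    refine (Module.End.finite_hasEigenvalue H).subset ?_
    rintro a ⟨μ, v, hv, -, -, h⟩
    exact Module.End.hasEigenvalue_of_hasEigenvector
      ⟨Module.End.mem_eigenspace_iff.mpr h, hv⟩
  have hne : S.Nonempty := by
    obtain ⟨γ, hγ⟩ : ∃ γ, 𝓜 γ ≠ ⊥ := by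
      by_contra! h
      have := hM.submodule_iSup_eq_top
      rw [iSup_eq_bot.mpr h] at this
      exact bot_ne_top this
    obtain ⟨u, hu, hu0, h⟩ := exists_common_eigenvector (fun i ↦ E i i)
      (fun i j u ↦ by
        rw [hE.diag_apply hω]
        by_cases h : i = j <;> simp [h, eq_comm]) hγ
      (fun i u hu ↦ by simpa using hdeg i i γ u hu) Finset.univ
    choose μ hμ using fun i ↦ h i (Finset.mem_univ i)
    exact ⟨_, μ, u, hu0, ⟨γ, hu⟩, hμ, hHv μ u hμ⟩
  -- A nonzero `E i j v` with `i < j` would be another homogeneous joint eigenvector, whose height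
  -- has real part smaller by `p j - p i > 0`.
  obtain ⟨a, ⟨μ, v, hv, ⟨γ, hγ⟩, hμ, ha⟩, hmin⟩ := Set.exists_min_image S Complex.re hfin hne
  refine ⟨μ, v, hv, ⟨γ, hγ⟩, fun i j hij ↦ ?_, hμ⟩
  by_contra hne
  have h1 := hmin (a + ((p i : ℂ) - p j))
    ⟨fun k ↦ μ k + ((if k = i then 1 else 0) - (if j = k then 1 else 0)), E i j v, hne,
      ⟨_, hdeg i j γ v hγ⟩, fun k ↦ ?_, ?_⟩
  · have h2 : (p i : ℝ) < p j := by exact_mod_cast hp hij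
    simp only [Complex.add_re, Complex.sub_re, Complex.natCast_re] at h1
    linarith
  · beta_reduce
    rw [hE.diag_apply hω, hμ, map_smul]
    split_ifs <;> module
  · rw [hH, hE.heightOperator_apply hω, ← hH, ha, map_smul, add_smul]

end GradedModules

/-! ### Colour commutators -/

/-- The colour commutator `x y - c y x` with commutation factor `c`. -/
def colourCommutator {A : Type*} [Ring A] [Algebra ℂ A] (c : ℂ) (x y : A) : A :=
  x * y - c • (y * x)

section ColourCommutator

variable {A : Type*} [Ring A] [Algebra ℂ A] {c c' c'' : ℂ} {x y z u w : A}

theorem colourCommutator_swap (hc : c * c' = 1) (h : colourCommutator c x y = u) :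
    colourCommutator c' y x = -(c' • u) := by
  rw [← h, colourCommutator, colourCommutator, smul_sub, smul_smul, mul_comm c', hc, one_smul]
  abel

/-- The colour Leibniz rule; `hc` holds for commutation factors because `ω` is a bicharacter. -/
theorem colourCommutator_mul_right (hc : c * c' = c'') (h : colourCommutator c x y = u)
    (h' : colourCommutator c' x z = w) :
    colourCommutator c'' x (y * z) = u * z + c • (y * w) := by
  rw [← h, ← h', ← hc]
  simp only [colourCommutator, sub_mul, mul_sub, smul_sub, smul_mul_assoc, mul_smul_comm,
    smul_smul, mul_assoc]
  abel

theorem colourCommutator_mul_left (hc : c * c' = c'') (h : colourCommutator c x z = u)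
    (h' : colourCommutator c' y z = w) :
    colourCommutator c'' (x * y) z = x * w + c' • (u * y) := by
  rw [← h, ← h', ← hc]
  simp only [colourCommutator, sub_mul, mul_sub, smul_sub, smul_mul_assoc, mul_smul_comm,
    smul_smul, mul_assoc, mul_comm c]
  abel

theorem colourCommutator_add_right :
    colourCommutator c x (y + z) = colourCommutator c x y + colourCommutator c x z := by
  simp only [colourCommutator, mul_add, add_mul, smul_add]
  abel

theorem colourCommutator_add_left :
    colourCommutator c (x + y) z = colourCommutator c x z + colourCommutator c y z := by
  simp only [colourCommutator, mul_add, add_mul, smul_add]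
  abel

theorem colourCommutator_sub_right :
    colourCommutator c x (y - z) = colourCommutator c x y - colourCommutator c x z := by
  simp only [colourCommutator, mul_sub, sub_mul, smul_sub]
  abel

theorem colourCommutator_sub_left :
    colourCommutator c (x - y) z = colourCommutator c x z - colourCommutator c y z := by
  simp only [colourCommutator, mul_sub, sub_mul, smul_sub]
  abel

theorem colourCommutator_smul_right :
    colourCommutator c x (c' • y) = c' • colourCommutator c x y := by
  simp only [colourCommutator, mul_smul_comm, smul_mul_assoc, smul_sub, smul_comm c]

theorem colourCommutator_smul_left :
    colourCommutator c (c' • x) y = c' • colourCommutator c x y := by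
  simp only [colourCommutator, mul_smul_comm, smul_mul_assoc, smul_sub, smul_comm c]

theorem colourCommutator_sum_right {κ : Type*} (s : Finset κ) (f : κ → A) :
    colourCommutator c x (∑ i ∈ s, f i) = ∑ i ∈ s, colourCommutator c x (f i) := by
  simp only [colourCommutator, Finset.mul_sum, Finset.sum_mul, Finset.smul_sum,
    Finset.sum_sub_distrib]

theorem colourCommutator_sum_left {κ : Type*} (s : Finset κ) (f : κ → A) :
    colourCommutator c (∑ i ∈ s, f i) x = ∑ i ∈ s, colourCommutator c (f i) x := by
  simp only [colourCommutator, Finset.mul_sum, Finset.sum_mul, Finset.smul_sum,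
    Finset.sum_sub_distrib]

theorem colourCommutator_one_one_left : colourCommutator 1 (1 : A) x = 0 := by
  simp [colourCommutator]

end ColourCommutator

namespace IsCommutativeFactor

variable {Γ : Type*} [AddCommGroup Γ] {ω : Γ → Γ → ℂˣ}

theorem coe_mul_left (hω : IsCommutativeFactor ω) {x y z t : Γ} (h : x + y = t) :
    (ω x z : ℂ) * ω y z = ω t z := by
  rw [← h, hω.map_add_left, Units.val_mul]

theorem coe_mul_right (hω : IsCommutativeFactor ω) {x y z t : Γ} (h : x + y = t) :
    (ω z x : ℂ) * ω z y = ω z t := by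
  rw [← h, hω.map_add_right, Units.val_mul]

theorem coe_mul_swap (hω : IsCommutativeFactor ω) (x y : Γ) : (ω x y : ℂ) * ω y x = 1 := by
  rw [← Units.val_mul, hω.mul_swap, Units.val_one]

theorem neg_neg (hω : IsCommutativeFactor ω) (x y : Γ) : ω (-x) (-y) = ω x y := by
  rw [hω.neg_left, hω.neg_right, inv_inv]

end IsCommutativeFactor

/-! ### Extending a representation of the matrix units by one index -/

/-- Operators `X a`, `D a` satisfying the colour Weyl relations, together with operators `F a b`
that satisfy the matrix unit relations and colour commute with them. The degrees of `X a`, `D a`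
and `F a b` are `d a - d₀`, `d₀ - d a` and `d a - d b`. -/
structure IsWeylSystem {Γ κ M : Type*} [AddCommGroup Γ] [DecidableEq κ] [AddCommGroup M]
    [Module ℂ M] (ω : Γ → Γ → ℂˣ) (d₀ : Γ) (d : κ → Γ) (X D : κ → Module.End ℂ M)
    (F : κ → κ → Module.End ℂ M) : Prop where
  xx : ∀ a c, colourCommutator (ω (d a - d₀) (d c - d₀) : ℂ) (X a) (X c) = 0
  dd : ∀ a c, colourCommutator (ω (d₀ - d a) (d₀ - d c) : ℂ) (D a) (D c) = 0
  dx : ∀ a c, colourCommutator (ω (d₀ - d a) (d c - d₀) : ℂ) (D a) (X c) = if a = c then 1 else 0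
  fx : ∀ a b c, colourCommutator (ω (d a - d b) (d c - d₀) : ℂ) (F a b) (X c) = 0
  fd : ∀ a b c, colourCommutator (ω (d a - d b) (d₀ - d c) : ℂ) (F a b) (D c) = 0
  ff : IsMatrixUnitRep ω d F

namespace IsWeylSystem

variable {Γ κ M : Type*} [AddCommGroup Γ] [DecidableEq κ] [AddCommGroup M]
  [Module ℂ M] {ω : Γ → Γ → ℂˣ} {d₀ : Γ} {d : κ → Γ} {X D : κ → Module.End ℂ M}
  {F : κ → κ → Module.End ℂ M}

theorem xd_x (hω : IsCommutativeFactor ω) (h : IsWeylSystem ω d₀ d X D F) (i j k : κ) :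
    colourCommutator (ω (d i - d j) (d k - d₀) : ℂ) (X i * D j) (X k) =
      if j = k then X i else 0 := by
  rw [colourCommutator_mul_left (hω.coe_mul_left (by abel)) (h.xx i k) (h.dx j k)]
  simp

theorem x_d (hω : IsCommutativeFactor ω) (h : IsWeylSystem ω d₀ d X D F) (i k : κ) :
    colourCommutator (ω (d i - d₀) (d₀ - d k) : ℂ) (X i) (D k) =
      -((ω (d i - d₀) (d₀ - d k) : ℂ) • if k = i then 1 else 0) :=
  colourCommutator_swap (hω.coe_mul_swap _ _) (h.dx k i)

theorem xd_d (hω : IsCommutativeFactor ω) (h : IsWeylSystem ω d₀ d X D F) (i j k : κ) :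
    colourCommutator (ω (d i - d j) (d₀ - d k) : ℂ) (X i * D j) (D k) =
      -((ω (d i - d j) (d₀ - d k) : ℂ) • if k = i then D j else 0) := by
  rw [colourCommutator_mul_left (hω.coe_mul_left (by abel)) (h.x_d hω i k) (h.dd j k),
    mul_zero, zero_add, neg_mul, smul_neg, smul_mul_assoc, smul_smul, mul_comm,
    hω.coe_mul_left (t := d i - d j) (by abel)]
  simp

theorem xd_f (hω : IsCommutativeFactor ω) (h : IsWeylSystem ω d₀ d X D F) (i j k l : κ) :
    colourCommutator (ω (d i - d j) (d k - d l) : ℂ) (X i * D j) (F k l) = 0 := by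
  have h1 := colourCommutator_swap (hω.coe_mul_swap _ _) (h.fx k l i)
  have h2 := colourCommutator_swap (hω.coe_mul_swap _ _) (h.fd k l j)
  rw [colourCommutator_mul_left (hω.coe_mul_left (by abel)) h1 h2]
  simp

theorem g_x (hω : IsCommutativeFactor ω) (h : IsWeylSystem ω d₀ d X D F) (i j k : κ) :
    colourCommutator (ω (d i - d j) (d k - d₀) : ℂ) (X i * D j + F i j) (X k) =
      if j = k then X i else 0 := by
  rw [colourCommutator_add_left, h.xd_x hω, h.fx, add_zero]

theorem g_d (hω : IsCommutativeFactor ω) (h : IsWeylSystem ω d₀ d X D F) (i j k : κ) :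
    colourCommutator (ω (d i - d j) (d₀ - d k) : ℂ) (X i * D j + F i j) (D k) =
      -((ω (d i - d j) (d₀ - d k) : ℂ) • if k = i then D j else 0) := by
  rw [colourCommutator_add_left, h.xd_d hω, h.fd, add_zero]

theorem d_g (hω : IsCommutativeFactor ω) (h : IsWeylSystem ω d₀ d X D F) (i j k : κ) :
    colourCommutator (ω (d₀ - d k) (d i - d j) : ℂ) (D k) (X i * D j + F i j) =
      if k = i then D j else 0 := by
  rw [colourCommutator_swap (hω.coe_mul_swap _ _) (h.g_d hω i j k), smul_neg, smul_smul,
    hω.coe_mul_swap, one_smul, neg_neg]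

theorem g_g (hω : IsCommutativeFactor ω) (h : IsWeylSystem ω d₀ d X D F) (i j k l : κ) :
    colourCommutator (ω (d i - d j) (d k - d l) : ℂ) (X i * D j + F i j) (X k * D l + F k l) =
      (if j = k then X i * D l + F i l else 0) -
        (ω (d i - d j) (d k - d l) : ℂ) • (if l = i then X k * D j + F k j else 0) := by
  have hff : colourCommutator (ω (d i - d j) (d k - d l) : ℂ) (F i j) (F k l) = _ := h.ff i j k l
  rw [colourCommutator_add_right,
    colourCommutator_mul_right (hω.coe_mul_right (by abel)) (h.g_x hω i j k) (h.g_d hω i j l),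
    colourCommutator_add_left, h.xd_f hω, hff, zero_add, mul_neg, smul_neg, mul_smul_comm,
    smul_smul, hω.coe_mul_right (t := d k - d l) (by abel)]
  split_ifs <;> simp <;> abel

variable [Fintype κ]

theorem n_x (hω : IsCommutativeFactor ω) (h : IsWeylSystem ω d₀ d X D F) (k : κ) :
    colourCommutator 1 (∑ a, X a * D a) (X k) = X k := by
  have h1 : ∀ a, colourCommutator 1 (X a * D a) (X k) = if a = k then X a else 0 := fun a ↦ by
    have := h.xd_x hω a a k
    rwa [sub_self, hω.zero_left, Units.val_one] at this
  simp [colourCommutator_sum_left, h1]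

theorem n_d (hω : IsCommutativeFactor ω) (h : IsWeylSystem ω d₀ d X D F) (k : κ) :
    colourCommutator 1 (∑ a, X a * D a) (D k) = -D k := by
  have h1 : ∀ a, colourCommutator 1 (X a * D a) (D k) = -(if k = a then D a else 0) := fun a ↦ by
    have := h.xd_d hω a a k
    rwa [sub_self, hω.zero_left, Units.val_one, one_smul] at this
  simp [colourCommutator_sum_left, h1]

theorem n_g (hω : IsCommutativeFactor ω) (h : IsWeylSystem ω d₀ d X D F) (k l : κ) :
    colourCommutator 1 (∑ a, X a * D a) (X k * D l + F k l) = 0 := by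
  have h1 : ∀ a, colourCommutator 1 (X a * D a) (F k l) = 0 := fun a ↦ by
    have := h.xd_f hω a a k l
    rwa [sub_self, hω.zero_left, Units.val_one] at this
  rw [colourCommutator_add_right, colourCommutator_mul_right (one_mul 1) (h.n_x hω k) (h.n_d hω l),
    colourCommutator_sum_left]
  simp [h1]

end IsWeylSystem

/-- The operator by which `E_{0b}` acts on the extended representation. -/
def extendRaise {Γ κ M : Type*} [AddCommGroup Γ] [Fintype κ] [AddCommGroup M]
    [Module ℂ M] (ω : Γ → Γ → ℂˣ) (d₀ : Γ) (d : κ → Γ) (X D : κ → Module.End ℂ M)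
    (F : κ → κ → Module.End ℂ M) (c : ℂ) (b : κ) : Module.End ℂ M :=
  -- In a Weyl system, with `ε a = ω (d a - d₀) (d a - d₀)`, one has `ε a • (D a * X a) = X a * D a
  -- + ε a • 1`. The added constant thus cancels the normal-ordering terms, and the operator equals
  -- `(c - ∑ a, X a D a) D b - ∑ a, ε a D a F a b`.
  (c + ∑ a, (ω (d a - d₀) (d a - d₀) : ℂ)) • D b -
    ∑ a, (ω (d a - d₀) (d a - d₀) : ℂ) • (D a * (X a * D b + F a b))

/-! ### Brackets with the new raising operators -/

namespace IsWeylSystem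

variable {Γ κ M : Type*} [AddCommGroup Γ] [DecidableEq κ] [Fintype κ] [AddCommGroup M]
  [Module ℂ M] {ω : Γ → Γ → ℂˣ} {d₀ : Γ} {d : κ → Γ} {X D : κ → Module.End ℂ M}
  {F : κ → κ → Module.End ℂ M}

theorem n_raise (hω : IsCommutativeFactor ω) (h : IsWeylSystem ω d₀ d X D F) (c : ℂ) (b : κ) :
    colourCommutator 1 (∑ a, X a * D a) (extendRaise ω d₀ d X D F c b) =
      -extendRaise ω d₀ d X D F c b := by
  rw [extendRaise, colourCommutator_sub_right, colourCommutator_smul_right, h.n_d hω,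
    colourCommutator_sum_right]
  simp only [colourCommutator_smul_right,
    colourCommutator_mul_right (one_mul 1) (h.n_d hω _) (h.n_g hω _ _)]
  simp
  abel

theorem raise_x (hω : IsCommutativeFactor ω) (h : IsWeylSystem ω d₀ d X D F) (c : ℂ) (b k : κ) :
    colourCommutator (ω (d₀ - d b) (d k - d₀) : ℂ) (extendRaise ω d₀ d X D F c b) (X k) =
      (if b = k then c • 1 - ∑ a, X a * D a else 0) -
        (ω (d₀ - d b) (d k - d₀) : ℂ) • (X k * D b + F k b) := by
  have h1 : ∀ a, colourCommutator (ω (d₀ - d b) (d k - d₀) : ℂ) (D a * (X a * D b + F a b)) (X k) =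
      (if b = k then D a * X a else 0) +
        (ω (d a - d b) (d k - d₀) : ℂ) • (if a = k then X a * D b + F a b else 0) := by
    intro a
    rw [colourCommutator_mul_left (hω.coe_mul_left (by abel)) (h.dx a k) (h.g_x hω a b k)]
    split_ifs <;> simp
  have h2 : ∀ a, D a * X a = (ω (d a - d₀) (d a - d₀) : ℂ) • (X a * D a) + 1 := by
    intro a
    have := h.dx a a
    rw [colourCommutator, if_pos rfl, sub_eq_iff_eq_add'] at this
    rw [this, ← neg_sub (d a) d₀, hω.neg_left, ← hω.symm]
  have h3 : ∀ a, (ω (d a - d₀) (d a - d₀) : ℂ) * ω (d a - d₀) (d a - d₀) = 1 := fun a ↦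
    hω.coe_mul_swap _ _
  rw [extendRaise, colourCommutator_sub_left, colourCommutator_smul_left, h.dx,
    colourCommutator_sum_left]
  simp only [colourCommutator_smul_left, h1, smul_add, Finset.sum_add_distrib, smul_smul]
  have h4 : ∑ a, ((ω (d a - d₀) (d a - d₀) : ℂ) * (ω (d a - d b) (d k - d₀) : ℂ)) •
      (if a = k then X a * D b + F a b else 0) =
      (ω (d₀ - d b) (d k - d₀) : ℂ) • (X k * D b + F k b) := by
    simp only [smul_ite, smul_zero, Finset.sum_ite_eq', Finset.mem_univ, if_true]
    congr 1
    rw [← hω.neg_neg (d k - d₀) (d k - d₀), hω.neg_left, ← hω.symm, neg_sub]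
    exact hω.coe_mul_left (by abel)
  rw [h4]
  by_cases hbk : b = k
  · simp only [hbk, if_true, h2, smul_add, smul_smul, h3, Finset.sum_add_distrib, one_smul,
      ← Finset.sum_smul, add_smul]
    abel
  · simp [hbk]

theorem d_raise (hω : IsCommutativeFactor ω) (h : IsWeylSystem ω d₀ d X D F) (c : ℂ) (a b : κ) :
    colourCommutator (ω (d₀ - d a) (d₀ - d b) : ℂ) (D a) (extendRaise ω d₀ d X D F c b) =
      -(D a * D b) := by
  have h1 : ∀ i, colourCommutator (ω (d₀ - d a) (d₀ - d b) : ℂ) (D a) (D i * (X i * D b + F i b)) =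
      (ω (d₀ - d a) (d₀ - d i) : ℂ) • (if a = i then D i * D b else 0) := by
    intro i
    rw [colourCommutator_mul_right (hω.coe_mul_right (by abel)) (h.dd a i) (h.d_g hω i b a)]
    simp
  rw [extendRaise, colourCommutator_sub_right, colourCommutator_smul_right, h.dd,
    colourCommutator_sum_right]
  simp only [colourCommutator_smul_right, h1, smul_smul, smul_zero, zero_sub, smul_ite,
    Finset.sum_ite_eq, Finset.mem_univ, if_true]
  rw [← hω.neg_neg (d a - d₀), neg_sub, hω.coe_mul_swap, one_smul]

theorem g_raise (hω : IsCommutativeFactor ω) (h : IsWeylSystem ω d₀ d X D F) (c : ℂ) (i j b : κ) :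
    colourCommutator (ω (d i - d j) (d₀ - d b) : ℂ) (X i * D j + F i j)
      (extendRaise ω d₀ d X D F c b) =
      -((ω (d i - d j) (d₀ - d b) : ℂ) •
        if b = i then extendRaise ω d₀ d X D F c j else 0) := by
  have h1 : ∀ a, colourCommutator (ω (d i - d j) (d₀ - d b) : ℂ) (X i * D j + F i j)
      (D a * (X a * D b + F a b)) =
      (if j = a then (ω (d i - d j) (d₀ - d a) : ℂ) • (D a * (X i * D b + F i b)) else 0) -
      (if a = i then (ω (d i - d j) (d₀ - d a) : ℂ) • (D j * (X a * D b + F a b)) else 0) -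
      (if b = i then (ω (d i - d j) (d₀ - d b) : ℂ) • (D a * (X a * D j + F a j)) else 0) := by
    intro a
    rw [colourCommutator_mul_right (hω.coe_mul_right (by abel)) (h.g_d hω i j a)
      (h.g_g hω i j a b), mul_sub, smul_sub, mul_smul_comm, smul_smul,
      hω.coe_mul_right (t := d₀ - d b) (by abel)]
    split_ifs <;> simp <;> abel
  -- With this equality the `j = a` and `a = i` contributions to the sum over `a` cancel.
  have h2 : (ω (d i - d₀) (d i - d₀) : ℂ) * ω (d i - d j) (d₀ - d i) =
      (ω (d j - d₀) (d j - d₀) : ℂ) * ω (d i - d j) (d₀ - d j) := by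
    rw [hω.sub_sub_self, hω.sub_sub_self]
    have h3 : (ω (d i - d j) (d₀ - d j) : ℂ) =
        ω (d i - d j) (d₀ - d i) * (ω (d i) (d i) * ω (d j) (d j)) := by
      rw [← Units.val_mul (ω (d i) (d i)), ← hω.sub_sub_self]
      exact (hω.coe_mul_right (by abel)).symm
    rw [h3]
    push_cast
    linear_combination -(ω (d i) (d i) * ω d₀ d₀ * ω (d i - d j) (d₀ - d i) : ℂ) *
      hω.coe_mul_swap (d j) (d j)
  rw [extendRaise, colourCommutator_sub_right, colourCommutator_smul_right, h.g_d hω,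
    colourCommutator_sum_right]
  simp only [colourCommutator_smul_right, h1, smul_sub, smul_smul, smul_zero, smul_ite,
    Finset.sum_ite_eq, Finset.sum_ite_eq', Finset.sum_sub_distrib, Finset.mem_univ, if_true, h2,
    sub_self, zero_sub]
  by_cases hbi : b = i
  · simp only [hbi, if_true, extendRaise, smul_sub, smul_smul, Finset.smul_sum, smul_neg,
      mul_comm (ω (d i - d j) (d₀ - d i) : ℂ)]
    abel
  · simp [hbi]

/-- Only the first operator need be expanded, since its factors `D i` and `X i * D a + F i a` have
known brackets with the second; what remains cancels because the `D`'s colour commute. -/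
theorem raise_raise (hω : IsCommutativeFactor ω) (h : IsWeylSystem ω d₀ d X D F) (c : ℂ)
    (a b : κ) :
    colourCommutator (ω (d₀ - d a) (d₀ - d b) : ℂ) (extendRaise ω d₀ d X D F c a)
      (extendRaise ω d₀ d X D F c b) = 0 := by
  have hdd : ∀ i j, D i * D j = (ω (d₀ - d i) (d₀ - d j) : ℂ) • (D j * D i) := fun i j ↦
    sub_eq_zero.mp (h.dd i j)
  have h1 : ∀ i, colourCommutator (ω (d₀ - d a) (d₀ - d b) : ℂ) (D i * (X i * D a + F i a))
      (extendRaise ω d₀ d X D F c b) =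
      -(if b = i then (ω (d i - d a) (d₀ - d b) : ℂ) • (D i * extendRaise ω d₀ d X D F c a)
        else 0) - (ω (d₀ - d a) (d₀ - d b) : ℂ) • (D b * (D i * (X i * D a + F i a))) := by
    intro i
    rw [colourCommutator_mul_left (hω.coe_mul_left (by abel)) (h.d_raise hω c i b)
      (h.g_raise hω c i a b), hdd i b, neg_mul, smul_neg, smul_mul_assoc, smul_smul,
      mul_comm (ω (d i - d a) _ : ℂ), hω.coe_mul_left (t := d₀ - d a) (by abel), mul_assoc]
    split_ifs
    · simp
      abel
    · simp
  have h2 : (ω (d b - d₀) (d b - d₀) : ℂ) * ω (d b - d a) (d₀ - d b) =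
      ω (d₀ - d a) (d₀ - d b) := by
    rw [← hω.neg_neg (d b - d₀), neg_sub]
    exact hω.coe_mul_left (by abel)
  conv_lhs => rw [extendRaise]
  rw [colourCommutator_sub_left, colourCommutator_smul_left, h.d_raise hω,
    colourCommutator_sum_left]
  simp only [colourCommutator_smul_left, h1, smul_sub, smul_smul, smul_neg, smul_ite, smul_zero,
    Finset.sum_sub_distrib, Finset.sum_neg_distrib, Finset.sum_ite_eq, Finset.mem_univ, if_true,
    h2]
  rw [extendRaise, hdd a b, mul_sub, smul_sub, mul_smul_comm, Finset.mul_sum, Finset.smul_sum]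
  simp only [mul_smul_comm, smul_smul, mul_comm (ω (d₀ - d a) (d₀ - d b) : ℂ)]
  abel

end IsWeylSystem

/-- The extension of a Weyl system to operators indexed by one more index. -/
def extendRep {Γ M : Type*} [AddCommGroup Γ] {n : ℕ} [AddCommGroup M]
    [Module ℂ M] (ω : Γ → Γ → ℂˣ) (d : Fin (n + 1) → Γ) (X D : Fin n → Module.End ℂ M)
    (F : Fin n → Fin n → Module.End ℂ M) (c : ℂ) : Fin (n + 1) → Fin (n + 1) → Module.End ℂ M :=
  fun i j ↦ Fin.cases
    (Fin.cases (c • 1 - ∑ a, X a * D a) (extendRaise ω (d 0) (fun a ↦ d a.succ) X D F c) j)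
    (fun a ↦ Fin.cases (X a) (fun b ↦ X a * D b + F a b) j) i

theorem IsWeylSystem.extendRep {Γ M : Type*} [AddCommGroup Γ] {n : ℕ} [AddCommGroup M]
    [Module ℂ M] {ω : Γ → Γ → ℂˣ} (hω : IsCommutativeFactor ω) {d : Fin (n + 1) → Γ}
    {X D : Fin n → Module.End ℂ M} {F : Fin n → Fin n → Module.End ℂ M} (c : ℂ)
    (h : IsWeylSystem ω (d 0) (fun a ↦ d a.succ) X D F) :
    IsMatrixUnitRep ω d (extendRep ω d X D F c) := by
  set E := ColourLie.extendRep ω d X D F c with hE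
  have e00 : E 0 0 = c • 1 - ∑ a, X a * D a := rfl
  have e0s : ∀ b, E 0 (Fin.succ b) = extendRaise ω (d 0) (fun a ↦ d a.succ) X D F c b :=
    fun b ↦ rfl
  have es0 : ∀ a, E (Fin.succ a) 0 = X a := fun a ↦ rfl
  have ess : ∀ a b, E (Fin.succ a) (Fin.succ b) = X a * D b + F a b := fun a b ↦ rfl
  let P : Fin (n + 1) → Fin (n + 1) → Fin (n + 1) → Fin (n + 1) → Prop := fun i j k l ↦
    colourCommutator (ω (d i - d j) (d k - d l) : ℂ) (E i j) (E k l) =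
      (if j = k then E i l else 0) -
      (ω (d i - d j) (d k - d l) : ℂ) • (if l = i then E k j else 0)
  -- Colour antisymmetry reduces the sixteen zero-or-successor cases to ten.
  have swap : ∀ i j k l, P i j k l → P k l i j := by
    intro i j k l hP
    change colourCommutator _ _ _ = _
    rw [colourCommutator_swap (hω.coe_mul_swap _ _) hP, smul_sub, smul_smul, hω.coe_mul_swap,
      one_smul, neg_sub]
  have pA : ∀ x, colourCommutator 1 (E 0 0) x = -colourCommutator 1 (∑ a, X a * D a) x := by
    intro x
    rw [e00, colourCommutator_sub_left, colourCommutator_smul_left, colourCommutator_one_one_left,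
      smul_zero, zero_sub]
  have pAA : P 0 0 0 0 := by
    simp [P, hω.zero_left, colourCommutator]
  have pAB : ∀ b : Fin n, P 0 0 0 b.succ := by
    intro b
    simp [P, hω.zero_left, pA, e0s, h.n_raise hω]
  have pAC : ∀ a : Fin n, P 0 0 a.succ 0 := by
    intro a
    simp [P, hω.zero_left, pA, es0, h.n_x hω, (Fin.succ_ne_zero a).symm]
  have pAG : ∀ a b : Fin n, P 0 0 a.succ b.succ := by
    intro a b
    simp [P, hω.zero_left, pA, ess, h.n_g hω, (Fin.succ_ne_zero a).symm]
  have pBB : ∀ a b : Fin n, P 0 a.succ 0 b.succ := by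
    intro a b
    simp [P, e0s, h.raise_raise hω]
  have pBC : ∀ b k : Fin n, P 0 b.succ k.succ 0 := by
    intro b k
    simp [P, e0s, es0, ess, e00, h.raise_x hω]
  have pGB : ∀ i j b : Fin n, P i.succ j.succ 0 b.succ := by
    intro i j b
    simp [P, e0s, ess, h.g_raise hω]
  have pCC : ∀ a b : Fin n, P a.succ 0 b.succ 0 := by
    intro a b
    simp [P, es0, h.xx, (Fin.succ_ne_zero _).symm]
  have pGC : ∀ i j b : Fin n, P i.succ j.succ b.succ 0 := by
    intro i j b
    simp [P, es0, ess, h.g_x hω, (Fin.succ_ne_zero _).symm]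
  have pGG : ∀ i j k l : Fin n, P i.succ j.succ k.succ l.succ := by
    intro i j k l
    simp [P, ess, h.g_g hω]
  change ∀ i j k l, P i j k l
  intro i j k l
  induction i using Fin.cases <;> induction j using Fin.cases <;> induction k using Fin.cases <;>
    induction l using Fin.cases
  exacts [pAA, pAB _, pAC _, pAG _ _, swap _ _ _ _ (pAB _), pBB _ _, pBC _ _,
    swap _ _ _ _ (pGB _ _ _), swap _ _ _ _ (pAC _), swap _ _ _ _ (pBC _ _), pCC _ _,
    swap _ _ _ _ (pGC _ _ _), swap _ _ _ _ (pAG _ _), pGB _ _ _, pGC _ _ _, pGG _ _ _ _]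

/-! ### Graded spaces given by a basis with degrees -/

section BasisGrading

variable {Γ M β : Type*} [AddCommGroup M] [Module ℂ M]

/-- The span of the basis vectors of degree `γ`. -/
def gradedPiece (b : Module.Basis β ℂ M) (deg : β → Γ) (γ : Γ) : Submodule ℂ M :=
  Submodule.span ℂ {u | ∃ i, deg i = γ ∧ u = b i}

theorem basis_mem_gradedPiece (b : Module.Basis β ℂ M) (deg : β → Γ) (i : β) :
    b i ∈ gradedPiece b deg (deg i) :=
  Submodule.subset_span ⟨i, rfl, rfl⟩

theorem isInternal_gradedPiece [DecidableEq Γ] (b : Module.Basis β ℂ M) (deg : β → Γ) :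
    DirectSum.IsInternal (gradedPiece b deg) := by
  refine isInternal_of_projections ?_
    (fun γ ↦ b.constr ℂ fun i ↦ if deg i = γ then b i else 0) ?_ ?_
  · rw [eq_top_iff, ← b.span_eq, Submodule.span_le]
    rintro _ ⟨i, rfl⟩
    exact Submodule.mem_iSup_of_mem (deg i) (basis_mem_gradedPiece b deg i)
  · intro γ u hu
    induction hu using Submodule.span_induction with
    | mem u h => obtain ⟨i, rfl, rfl⟩ := h; simp
    | zero => simp
    | add u v _ _ hu hv => rw [map_add, hu, hv]
    | smul c u _ hu => rw [map_smul, hu]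
  · intro γ δ hγδ u hu
    induction hu using Submodule.span_induction with
    | mem u h => obtain ⟨i, rfl, rfl⟩ := h; simp [hγδ.symm]
    | zero => simp
    | add u v _ _ hu hv => rw [map_add, hu, hv, add_zero]
    | smul c u _ hu => rw [map_smul, hu, smul_zero]

/-- The operator that multiplies vectors of degree `γ` by `ω(δ, γ)`. -/
def colourTwist (ω : Γ → Γ → ℂˣ) (b : Module.Basis β ℂ M) (deg : β → Γ) (δ : Γ) :
    Module.End ℂ M :=
  b.constr ℂ fun i ↦ (ω δ (deg i) : ℂ) • b i

theorem colourTwist_apply {ω : Γ → Γ → ℂˣ} {b : Module.Basis β ℂ M} {deg : β → Γ} {δ γ : Γ}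
    {u : M} (hu : u ∈ gradedPiece b deg γ) :
    colourTwist ω b deg δ u = (ω δ γ : ℂ) • u := by
  induction hu using Submodule.span_induction with
  | mem u h => obtain ⟨i, rfl, rfl⟩ := h; simp [colourTwist]
  | zero => simp
  | add u v _ _ hu hv => rw [map_add, hu, hv, smul_add]
  | smul c u _ hu => rw [map_smul, hu, smul_comm]

variable [AddCommGroup Γ]

/-- `T` maps vectors of degree `γ` to vectors of degree `t + γ`. -/
def IsHomogeneousOp (b : Module.Basis β ℂ M) (deg : β → Γ) (t : Γ) (T : Module.End ℂ M) : Prop :=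
  ∀ i, T (b i) ∈ gradedPiece b deg (t + deg i)

theorem IsHomogeneousOp.apply_mem {b : Module.Basis β ℂ M} {deg : β → Γ} {t : Γ}
    {T : Module.End ℂ M} (hT : IsHomogeneousOp b deg t T) {γ : Γ} {u : M}
    (hu : u ∈ gradedPiece b deg γ) : T u ∈ gradedPiece b deg (t + γ) := by
  induction hu using Submodule.span_induction with
  | mem u h => obtain ⟨i, rfl, rfl⟩ := h; exact hT i
  | zero => simp
  | add u v _ _ hu hv => rw [map_add]; exact Submodule.add_mem _ hu hv
  | smul c u _ hu => rw [map_smul]; exact Submodule.smul_mem _ _ hu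

theorem IsHomogeneousOp.one (b : Module.Basis β ℂ M) (deg : β → Γ) :
    IsHomogeneousOp b deg 0 1 := fun i ↦ by
  simpa using basis_mem_gradedPiece b deg i

theorem IsHomogeneousOp.mul {b : Module.Basis β ℂ M} {deg : β → Γ} {t s r : Γ}
    {T S : Module.End ℂ M} (hT : IsHomogeneousOp b deg t T) (hS : IsHomogeneousOp b deg s S)
    (h : t + s = r) : IsHomogeneousOp b deg r (T * S) := fun i ↦ by
  rw [← h, add_assoc]
  exact hT.apply_mem (hS i)

theorem IsHomogeneousOp.add {b : Module.Basis β ℂ M} {deg : β → Γ} {t : Γ}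
    {T S : Module.End ℂ M} (hT : IsHomogeneousOp b deg t T) (hS : IsHomogeneousOp b deg t S) :
    IsHomogeneousOp b deg t (T + S) := fun i ↦ Submodule.add_mem _ (hT i) (hS i)

theorem IsHomogeneousOp.sub {b : Module.Basis β ℂ M} {deg : β → Γ} {t : Γ}
    {T S : Module.End ℂ M} (hT : IsHomogeneousOp b deg t T) (hS : IsHomogeneousOp b deg t S) :
    IsHomogeneousOp b deg t (T - S) := fun i ↦ Submodule.sub_mem _ (hT i) (hS i)

theorem IsHomogeneousOp.smul {b : Module.Basis β ℂ M} {deg : β → Γ} {t : Γ}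
    {T : Module.End ℂ M} (c : ℂ) (hT : IsHomogeneousOp b deg t T) :
    IsHomogeneousOp b deg t (c • T) := fun i ↦ Submodule.smul_mem _ _ (hT i)

theorem IsHomogeneousOp.sum {b : Module.Basis β ℂ M} {deg : β → Γ} {t : Γ} {κ : Type*}
    {s : Finset κ} {T : κ → Module.End ℂ M} (hT : ∀ k ∈ s, IsHomogeneousOp b deg t (T k)) :
    IsHomogeneousOp b deg t (∑ k ∈ s, T k) := fun i ↦ by
  rw [LinearMap.sum_apply]
  exact Submodule.sum_mem _ fun k hk ↦ hT k hk i

variable {ω : Γ → Γ → ℂˣ} {b : Module.Basis β ℂ M} {deg : β → Γ}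

theorem colourTwist_isHomogeneousOp (δ : Γ) :
    IsHomogeneousOp b deg 0 (colourTwist ω b deg δ) := fun i ↦ by
  rw [colourTwist_apply (basis_mem_gradedPiece b deg i), zero_add]
  exact Submodule.smul_mem _ _ (basis_mem_gradedPiece b deg i)

theorem colourTwist_mul_colourTwist (hω : IsCommutativeFactor ω) {δ ε η : Γ} (h : δ + ε = η) :
    colourTwist ω b deg δ * colourTwist ω b deg ε = colourTwist ω b deg η := by
  refine b.ext fun i ↦ ?_
  have hi := basis_mem_gradedPiece b deg i
  rw [Module.End.mul_apply, colourTwist_apply hi, map_smul, colourTwist_apply hi,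
    colourTwist_apply hi, smul_smul, mul_comm, hω.coe_mul_left h]

theorem colourTwist_zero (hω : IsCommutativeFactor ω) : colourTwist ω b deg 0 = 1 := by
  refine b.ext fun i ↦ ?_
  rw [colourTwist_apply (basis_mem_gradedPiece b deg i), hω.zero_left]
  simp

/-- A Klein (Jordan–Wigner) factor: placed on one tensor factor, the twist makes operators living on
different factors colour commute. -/
theorem colourTwist_mul (hω : IsCommutativeFactor ω) {δ t : Γ} {T : Module.End ℂ M}
    (hT : IsHomogeneousOp b deg t T) :
    colourTwist ω b deg δ * T = (ω δ t : ℂ) • (T * colourTwist ω b deg δ) := by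
  refine b.ext fun i ↦ ?_
  rw [Module.End.mul_apply, colourTwist_apply (hT i), LinearMap.smul_apply, Module.End.mul_apply,
    colourTwist_apply (basis_mem_gradedPiece b deg i), map_smul, smul_smul,
    hω.map_add_right, Units.val_mul]

open TensorProduct in
theorem tmul_mem_gradedPiece {M' β' : Type*} [AddCommGroup M'] [Module ℂ M']
    {b' : Module.Basis β' ℂ M'} {deg' : β' → Γ} {γ δ ε : Γ} {u : M} {u' : M'}
    (hu : u ∈ gradedPiece b deg γ) (hu' : u' ∈ gradedPiece b' deg' δ) (h : γ + δ = ε) :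
    u ⊗ₜ[ℂ] u' ∈ gradedPiece (b.tensorProduct b') (fun i ↦ deg i.1 + deg' i.2) ε := by
  subst h
  induction hu using Submodule.span_induction with
  | mem u h =>
    obtain ⟨i, rfl, rfl⟩ := h
    induction hu' using Submodule.span_induction with
    | mem u h =>
      obtain ⟨j, rfl, rfl⟩ := h
      exact Submodule.subset_span ⟨(i, j), rfl, (Module.Basis.tensorProduct_apply ..).symm⟩
    | zero => simp
    | add u v _ _ hu hv => rw [TensorProduct.tmul_add]; exact Submodule.add_mem _ hu hv
    | smul c u _ hu => rw [TensorProduct.tmul_smul]; exact Submodule.smul_mem _ _ hu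
  | zero => simp
  | add u v _ _ hu hv => rw [TensorProduct.add_tmul]; exact Submodule.add_mem _ hu hv
  | smul c u _ hu => rw [← TensorProduct.smul_tmul']; exact Submodule.smul_mem _ _ hu

theorem IsHomogeneousOp.tensor {M' β' : Type*} [AddCommGroup M'] [Module ℂ M']
    {b' : Module.Basis β' ℂ M'} {deg' : β' → Γ} {t t' r : Γ} {T : Module.End ℂ M}
    {T' : Module.End ℂ M'} (hT : IsHomogeneousOp b deg t T) (hT' : IsHomogeneousOp b' deg' t' T')
    (h : t + t' = r) :
    IsHomogeneousOp (b.tensorProduct b') (fun i ↦ deg i.1 + deg' i.2) r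
      (TensorProduct.map T T') := fun i ↦ by
  rw [Module.Basis.tensorProduct_apply', TensorProduct.map_tmul]
  exact tmul_mem_gradedPiece (hT _) (hT' _) (by rw [← h, add_add_add_comm])

end BasisGrading

theorem tensorMap_sub_left {M N : Type*} [AddCommGroup M] [Module ℂ M] [AddCommGroup N]
    [Module ℂ N] (f g : Module.End ℂ M) (h : Module.End ℂ N) :
    TensorProduct.map (f - g) h = TensorProduct.map f h - TensorProduct.map g h :=
  TensorProduct.ext' fun u v ↦ by simp [TensorProduct.sub_tmul]

theorem tensorMap_sub_right {M N : Type*} [AddCommGroup M] [Module ℂ M] [AddCommGroup N]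
    [Module ℂ N] (f : Module.End ℂ M) (g h : Module.End ℂ N) :
    TensorProduct.map f (g - h) = TensorProduct.map f g - TensorProduct.map f h :=
  TensorProduct.ext' fun u v ↦ by simp [TensorProduct.tmul_sub]

theorem tmul_ne_zero {M N β : Type*} [AddCommGroup M] [Module ℂ M] [AddCommGroup N]
    [Module ℂ N] (b : Module.Basis β ℂ M) {u : M} {v : N} (hu : u ≠ 0) (hv : v ≠ 0) :
    TensorProduct.tmul ℂ u v ≠ 0 := by
  intro h0
  obtain ⟨i, hi⟩ : ∃ i, b.repr u i ≠ 0 := by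
    by_contra! h
    exact hu (b.repr.map_eq_zero_iff.mp (Finsupp.ext h))
  have hz := congrArg (TensorProduct.lift ((LinearMap.lsmul ℂ N).comp (b.coord i))) h0
  rw [TensorProduct.lift.tmul, map_zero, LinearMap.comp_apply, LinearMap.lsmul_apply] at hz
  exact (smul_ne_zero hi hv) hz

/-! ### Colour Fock spaces -/

/-- The raising and lowering operators `X a`, `D a` of degrees `δ a`, `-δ a` form a colour Fock
space with vacuum `v`. -/
structure IsFockSpace {Γ κ M β : Type*} [AddCommGroup Γ] [DecidableEq κ] [AddCommGroup M]
    [Module ℂ M] (ω : Γ → Γ → ℂˣ) (δ : κ → Γ) (b : Module.Basis β ℂ M) (deg : β → Γ)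
    (X D : κ → Module.End ℂ M) (v : M) : Prop where
  x_hom : ∀ a, IsHomogeneousOp b deg (δ a) (X a)
  d_hom : ∀ a, IsHomogeneousOp b deg (-δ a) (D a)
  vac_ne : v ≠ 0
  vac_mem : v ∈ gradedPiece b deg 0
  d_vac : ∀ a, D a v = 0
  xx : ∀ a c, colourCommutator (ω (δ a) (δ c) : ℂ) (X a) (X c) = 0
  dd : ∀ a c, colourCommutator (ω (-δ a) (-δ c) : ℂ) (D a) (D c) = 0
  dx : ∀ a c, colourCommutator (ω (-δ a) (δ c) : ℂ) (D a) (X c) = if a = c then 1 else 0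

/-- The one-variable operators: multiplication and differentiation on polynomials for `ε = 1`, and
their fermionic analogues for `ε = -1`. -/
theorem exists_oscillator {ε : ℂ} (hε : ε = 1 ∨ ε = -1) :
    ∃ (P : Type) (_ : AddCommGroup P) (_ : Module ℂ P) (B : Module.Basis ℕ ℂ P)
      (x y : Module.End ℂ P), (∀ k, ∃ c : ℂ, x (B k) = c • B (k + 1)) ∧ y (B 0) = 0 ∧
      (∀ k, ∃ c : ℂ, y (B (k + 1)) = c • B k) ∧
      x * x = ε • (x * x) ∧ y * y = ε • (y * y) ∧ y * x - ε • (x * y) = 1 := by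
  suffices h : ∃ p q : ℕ → ℂ, q 0 = 0 ∧ (∀ k, p (k + 1) * p k = ε * (p (k + 1) * p k)) ∧
      (∀ k, q (k + 1) * q k = ε * (q (k + 1) * q k)) ∧ p 0 * q 1 = 1 ∧
      ∀ k, p (k + 1) * q (k + 2) - ε * (q (k + 1) * p k) = 1 by
    obtain ⟨p, q, hq0, hp, hq, h1, hpq⟩ := h
    let B : Module.Basis ℕ ℂ (ℕ →₀ ℂ) := Finsupp.basisSingleOne
    have hx : ∀ k, B.constr ℂ (fun k ↦ p k • B (k + 1)) (B k) = p k • B (k + 1) := fun k ↦ by simp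
    have hy : ∀ k, B.constr ℂ (fun k ↦ q k • B (k - 1)) (B k) = q k • B (k - 1) := fun k ↦ by simp
    refine ⟨ℕ →₀ ℂ, inferInstance, inferInstance, B, B.constr ℂ fun k ↦ p k • B (k + 1), B.constr ℂ fun k ↦ q k • B (k - 1),
      fun k ↦ ⟨p k, ?_⟩, ?_, fun k ↦ ⟨q (k + 1), ?_⟩, B.ext fun k ↦ ?_, B.ext fun k ↦ ?_,
      B.ext fun k ↦ ?_⟩
    · rw [hx]
    · rw [hy, hq0, zero_smul]
    · rw [hy, Nat.add_sub_cancel]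
    · simp only [LinearMap.smul_apply, Module.End.mul_apply, hx, map_smul, smul_smul]
      rw [mul_comm (p k), ← hp]
    · simp only [LinearMap.smul_apply, Module.End.mul_apply, hy, map_smul, smul_smul]
      cases k with
      | zero => simp [hq0]
      | succ k => rw [Nat.add_sub_cancel, ← hq]
    · simp only [LinearMap.sub_apply, LinearMap.smul_apply, Module.End.mul_apply, hy, hx, map_smul,
        smul_smul, Nat.add_sub_cancel, Module.End.one_apply]
      cases k with
      | zero => simp [hq0, h1]
      | succ k => rw [Nat.add_sub_cancel, ← sub_smul, hpq, one_smul]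
  rcases hε with rfl | rfl
  · exact ⟨fun _ ↦ 1, fun k ↦ k, by simp, by simp, by simp, by simp, fun k ↦ by push_cast; ring⟩
  -- The basis `ℕ` is kept for uniformity: the fermionic space is a sum of copies of the
  -- two-dimensional Clifford module on `B (2m)`, `B (2m + 1)`. The redundancy is harmless, as only
  -- the vacuum `B 0` matters.
  · refine ⟨fun k ↦ if Even k then 1 else 0, fun k ↦ if Even k then 0 else 1, by simp,
      fun k ↦ ?_, fun k ↦ ?_, by simp, fun k ↦ ?_⟩ <;> by_cases hk : Even k <;>
      simp [hk, Nat.even_add_one]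

/-- One oscillator is tensored on per degree. Its operators carry the inverse twists by `δ 0` and
`-δ 0` on the remaining factor: these give the colour factors with the older operators and cancel in
the oscillator's own relation. -/
theorem exists_fockSpace {Γ : Type*} [AddCommGroup Γ] {ω : Γ → Γ → ℂˣ}
    (hω : IsCommutativeFactor ω) (n : ℕ) (δ : Fin n → Γ) :
    ∃ (M : Type) (_ : AddCommGroup M) (_ : Module ℂ M) (β : Type) (b : Module.Basis β ℂ M)
      (deg : β → Γ) (X D : Fin n → Module.End ℂ M) (v : M), IsFockSpace ω δ b deg X D v := by
  induction n with
  | zero =>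
    refine ⟨ℂ, inferInstance, inferInstance, Unit, Module.Basis.singleton Unit ℂ, fun _ ↦ 0,
      Fin.elim0, Fin.elim0, 1, ⟨fun a ↦ a.elim0, fun a ↦ a.elim0, one_ne_zero, ?_,
      fun a ↦ a.elim0, fun a ↦ a.elim0, fun a ↦ a.elim0, fun a ↦ a.elim0⟩⟩
    exact Submodule.subset_span ⟨(), rfl, by simp⟩
  | succ n ih =>
    obtain ⟨M, _, _, β, b, deg, X, D, v, h⟩ := ih fun a ↦ δ a.succ
    have hε : (ω (δ 0) (δ 0) : ℂ) = 1 ∨ (ω (δ 0) (δ 0) : ℂ) = -1 := by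
      rcases hω.self_eq_one_or (δ 0) with h | h <;> simp [h]
    obtain ⟨P, _, _, B, x, y, hx, hy0, hy, hxx, hyy, hyx⟩ := exists_oscillator hε
    let degB : ℕ → Γ := fun k ↦ k • δ 0
    have hxhom : IsHomogeneousOp B degB (δ 0) x := by
      intro k
      obtain ⟨c, hc⟩ := hx k
      rw [hc]
      refine Submodule.smul_mem _ _ (Submodule.subset_span ⟨k + 1, ?_, rfl⟩)
      simp only [degB]
      rw [succ_nsmul']
    have hyhom : IsHomogeneousOp B degB (-δ 0) y := by
      intro k
      cases k with
      | zero => rw [hy0]; exact Submodule.zero_mem _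
      | succ k =>
        obtain ⟨c, hc⟩ := hy k
        rw [hc]
        refine Submodule.smul_mem _ _ (Submodule.subset_span ⟨k, ?_, rfl⟩)
        simp only [degB]
        rw [succ_nsmul', neg_add_cancel_left]
    let K := colourTwist ω b deg
    have hK0 : K (-δ 0) * K (δ 0) = 1 := by
      rw [colourTwist_mul_colourTwist hω (neg_add_cancel _), colourTwist_zero hω]
    have hK0' : K (δ 0) * K (-δ 0) = 1 := by
      rw [colourTwist_mul_colourTwist hω (add_neg_cancel _), colourTwist_zero hω]
    let X' : Fin (n + 1) → Module.End ℂ (TensorProduct ℂ P M) :=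
      Fin.cons (TensorProduct.map x (K (δ 0))) fun a ↦ TensorProduct.map 1 (X a)
    let D' : Fin (n + 1) → Module.End ℂ (TensorProduct ℂ P M) :=
      Fin.cons (TensorProduct.map y (K (-δ 0))) fun a ↦ TensorProduct.map 1 (D a)
    have x0 : X' 0 = TensorProduct.map x (K (δ 0)) := rfl
    have xs : ∀ a : Fin n, X' a.succ = TensorProduct.map 1 (X a) := fun a ↦ rfl
    have d0 : D' 0 = TensorProduct.map y (K (-δ 0)) := rfl
    have ds : ∀ a : Fin n, D' a.succ = TensorProduct.map 1 (D a) := fun a ↦ rfl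
    have hswap : ∀ {a c : Γ} {x y : Module.End ℂ (TensorProduct ℂ P M)},
        colourCommutator (ω a c : ℂ) x y = 0 → colourCommutator (ω c a : ℂ) y x = 0 := by
      intro a c x y h
      rw [colourCommutator_swap (hω.coe_mul_swap a c) h, smul_zero, neg_zero]
    have hmixed : ∀ {T : Module.End ℂ P} {S : Module.End ℂ M} {ε s : Γ},
        IsHomogeneousOp b deg s S → colourCommutator (ω ε s : ℂ) (TensorProduct.map T (K ε))
          (TensorProduct.map 1 S) = 0 := by
      intro T S ε s hS
      rw [colourCommutator, ← TensorProduct.map_mul, ← TensorProduct.map_mul,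
        colourTwist_mul hω hS, TensorProduct.map_smul_right, mul_one, one_mul, sub_self]
    refine ⟨TensorProduct ℂ P M, inferInstance, inferInstance, ℕ × β, B.tensorProduct b,
      fun i ↦ degB i.1 + deg i.2, X', D', TensorProduct.tmul ℂ (B 0) v, ⟨?_, ?_, ?_, ?_, ?_, ?_,
      ?_, ?_⟩⟩
    · refine Fin.cases (hxhom.tensor (colourTwist_isHomogeneousOp _) (add_zero _)) fun a ↦ ?_
      exact (IsHomogeneousOp.one _ _).tensor (h.x_hom a) (zero_add _)
    · refine Fin.cases (hyhom.tensor (colourTwist_isHomogeneousOp _) (add_zero _)) fun a ↦ ?_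
      exact (IsHomogeneousOp.one _ _).tensor (h.d_hom a) (zero_add _)
    · exact tmul_ne_zero B (B.ne_zero 0) h.vac_ne
    · refine tmul_mem_gradedPiece (basis_mem_gradedPiece B degB 0) h.vac_mem ?_
      simp [degB]
    · refine Fin.cases ?_ fun a ↦ ?_
      · rw [d0, TensorProduct.map_tmul, hy0, TensorProduct.zero_tmul]
      · rw [ds, TensorProduct.map_tmul, h.d_vac, TensorProduct.tmul_zero]
    · refine Fin.cases (Fin.cases ?_ fun c ↦ ?_) fun a ↦ Fin.cases ?_ fun c ↦ ?_
      · rw [x0, colourCommutator, ← TensorProduct.map_mul, ← TensorProduct.map_smul_left, ← hxx,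
          sub_self]
      · exact hmixed (h.x_hom c)
      · exact hswap (hmixed (h.x_hom a))
      · rw [xs, xs, colourCommutator, ← TensorProduct.map_mul, ← TensorProduct.map_mul,
          ← TensorProduct.map_smul_right, sub_eq_zero.mp (h.xx a c), sub_self]
    · refine Fin.cases (Fin.cases ?_ fun c ↦ ?_) fun a ↦ Fin.cases ?_ fun c ↦ ?_
      · rw [d0, hω.neg_neg, colourCommutator, ← TensorProduct.map_mul,
          ← TensorProduct.map_smul_left, ← hyy, sub_self]
      · exact hmixed (h.d_hom c)
      · exact hswap (hmixed (h.d_hom a))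
      · rw [ds, ds, colourCommutator, ← TensorProduct.map_mul, ← TensorProduct.map_mul,
          ← TensorProduct.map_smul_right, sub_eq_zero.mp (h.dd a c), sub_self]
    · refine Fin.cases (Fin.cases ?_ fun c ↦ ?_) fun a ↦ Fin.cases ?_ fun c ↦ ?_
      · rw [d0, x0, colourCommutator, ← TensorProduct.map_mul, ← TensorProduct.map_mul, hK0, hK0',
          ← TensorProduct.map_smul_left, hω.neg_left, ← hω.symm, if_pos rfl]
        rw [sub_eq_iff_eq_add.mp hyx, TensorProduct.map_add_left, add_sub_cancel_right,
          TensorProduct.map_one]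
      · rw [if_neg (Fin.succ_ne_zero c).symm]
        exact hmixed (h.x_hom c)
      · rw [if_neg (Fin.succ_ne_zero a)]
        exact hswap (hmixed (h.d_hom a))
      · rw [ds, xs, colourCommutator, ← TensorProduct.map_mul, ← TensorProduct.map_mul,
          ← TensorProduct.map_smul_right]
        have := sub_eq_iff_eq_add.mp (h.dx a c)
        rw [this, TensorProduct.map_add_right, one_mul, add_sub_cancel_right]
        simp only [Fin.succ_inj]
        split_ifs
        · exact TensorProduct.map_one
        · exact TensorProduct.map_zero_right _

/-! ### Highest weight modules of arbitrary highest weight -/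

/-- The first label is split off: the Fock space supplies `X`, `D` of degrees `±(d a - d 0)`, and
the module for the other labels supplies `F`, twisted on the Fock factor so as to colour commute
with `X` and `D`. All `D a` kill the vacuum, so on vacuum vectors only `F` and the scalar `lam 0`
act in the relations of a singular vector. Generation is not claimed; it is arranged afterwards. -/
theorem exists_graded_singularVector {Γ : Type*} [AddCommGroup Γ] {ω : Γ → Γ → ℂˣ}
    (hω : IsCommutativeFactor ω) (n : ℕ) (d : Fin n → Γ) (lam : Fin n → ℂ) :
    ∃ (M : Type) (_ : AddCommGroup M) (_ : Module ℂ M) (β : Type) (b : Module.Basis β ℂ M)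
      (deg : β → Γ) (E : Fin n → Fin n → Module.End ℂ M) (v : M), IsMatrixUnitRep ω d E ∧
      (∀ i j, IsHomogeneousOp b deg (d i - d j) (E i j)) ∧ v ≠ 0 ∧ v ∈ gradedPiece b deg 0 ∧
      IsSingularVector E lam v := by
  induction n with
  | zero =>
    refine ⟨ℂ, inferInstance, inferInstance, Unit, Module.Basis.singleton Unit ℂ, fun _ ↦ 0,
      fun a ↦ a.elim0, 1, fun a ↦ a.elim0, fun a ↦ a.elim0, one_ne_zero, ?_,
      ⟨fun a ↦ a.elim0, fun a ↦ a.elim0⟩⟩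
    exact Submodule.subset_span ⟨(), rfl, by simp⟩
  | succ n ih =>
    obtain ⟨M', _, _, β', b', deg', E', v', hE', hhom', hv0', hv', hs'⟩ :=
      ih (fun a ↦ d a.succ) fun a ↦ lam a.succ
    obtain ⟨S, _, _, β, b, deg, X, D, v, h⟩ := exists_fockSpace hω n fun a ↦ d a.succ - d 0
    let K := colourTwist ω b deg
    let X' : Fin n → Module.End ℂ (TensorProduct ℂ S M') := fun a ↦ TensorProduct.map (X a) 1
    let D' : Fin n → Module.End ℂ (TensorProduct ℂ S M') := fun a ↦ TensorProduct.map (D a) 1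
    let F : Fin n → Fin n → Module.End ℂ (TensorProduct ℂ S M') := fun i j ↦
      TensorProduct.map (K (d i.succ - d j.succ)) (E' i j)
    have hdneg : ∀ a : Fin n, -(d a.succ - d 0) = d 0 - d a.succ := fun a ↦ neg_sub _ _
    have hone : ∀ {c : ℂ} {x y : Module.End ℂ S},
        colourCommutator c (TensorProduct.map x (1 : Module.End ℂ M')) (TensorProduct.map y 1) =
          TensorProduct.map (colourCommutator c x y) 1 := by
      intro c x y
      rw [colourCommutator, colourCommutator, ← TensorProduct.map_mul, ← TensorProduct.map_mul,
        one_mul, tensorMap_sub_left, TensorProduct.map_smul_left]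
    have hW : IsWeylSystem ω (d 0) (fun a ↦ d a.succ) X' D' F := by
      refine ⟨fun a c ↦ ?_, fun a c ↦ ?_, fun a c ↦ ?_, fun i j c ↦ ?_, fun i j c ↦ ?_,
        fun i j k l ↦ ?_⟩
      · rw [hone, h.xx, TensorProduct.map_zero_left]
      · have := h.dd a c
        rw [hdneg, hdneg] at this
        rw [hone, this, TensorProduct.map_zero_left]
      · have := h.dx a c
        rw [hdneg] at this
        rw [hone, this]
        split_ifs
        · exact TensorProduct.map_one
        · exact TensorProduct.map_zero_left _
      · rw [colourCommutator, ← TensorProduct.map_mul, ← TensorProduct.map_mul,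
          colourTwist_mul hω (h.x_hom c), TensorProduct.map_smul_left, mul_one, one_mul, sub_self]
      · have := h.d_hom c
        rw [hdneg] at this
        rw [colourCommutator, ← TensorProduct.map_mul, ← TensorProduct.map_mul,
          colourTwist_mul hω this, TensorProduct.map_smul_left, mul_one, one_mul, sub_self]
      · simp only [F]
        have := sub_eq_iff_eq_add.mp (hE' i j k l)
        rw [← TensorProduct.map_mul, ← TensorProduct.map_mul, colourTwist_mul_colourTwist hω rfl,
          colourTwist_mul_colourTwist hω (add_comm _ _), ← TensorProduct.map_smul_right, this,
          TensorProduct.map_add_right, add_sub_cancel_right, tensorMap_sub_right,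
          TensorProduct.map_smul_right]
        congr 2
        · split_ifs with hjk
          · rw [hjk, sub_add_sub_cancel]
          · exact TensorProduct.map_zero_right _
        · split_ifs with hli
          · rw [hli, add_comm, sub_add_sub_cancel]
          · exact TensorProduct.map_zero_right _
    have hX : ∀ a, IsHomogeneousOp (b.tensorProduct b') (fun i ↦ deg i.1 + deg' i.2)
        (d a.succ - d 0) (X' a) := fun a ↦
      (h.x_hom a).tensor (IsHomogeneousOp.one _ _) (add_zero _)
    have hD : ∀ a, IsHomogeneousOp (b.tensorProduct b') (fun i ↦ deg i.1 + deg' i.2)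
        (d 0 - d a.succ) (D' a) := fun a ↦
      (h.d_hom a).tensor (IsHomogeneousOp.one _ _) (by rw [add_zero, neg_sub])
    have hF : ∀ i j, IsHomogeneousOp (b.tensorProduct b') (fun i ↦ deg i.1 + deg' i.2)
        (d i.succ - d j.succ) (F i j) := fun i j ↦
      (colourTwist_isHomogeneousOp _).tensor (hhom' i j) (zero_add _)
    have hG : ∀ i j, IsHomogeneousOp (b.tensorProduct b') (fun i ↦ deg i.1 + deg' i.2)
        (d i.succ - d j.succ) (X' i * D' j + F i j) := fun i j ↦
      ((hX i).mul (hD j) (sub_add_sub_cancel _ _ _)).add (hF i j)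
    set w : TensorProduct ℂ S M' := TensorProduct.tmul ℂ v v' with hw
    have hDw : ∀ a u, D' a (TensorProduct.tmul ℂ v u) = 0 := fun a u ↦ by
      rw [TensorProduct.map_tmul, h.d_vac, TensorProduct.zero_tmul]
    have hFw : ∀ i j u, F i j (TensorProduct.tmul ℂ v u) = TensorProduct.tmul ℂ v (E' i j u) :=
      fun i j u ↦ by
        rw [TensorProduct.map_tmul, colourTwist_apply h.vac_mem, hω.zero_right, Units.val_one,
          one_smul]
    have hGw : ∀ i j, (X' i * D' j + F i j) w = TensorProduct.tmul ℂ v (E' i j v') :=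
      fun i j ↦ by
        rw [LinearMap.add_apply, Module.End.mul_apply, hDw, map_zero, zero_add, hFw]
    refine ⟨TensorProduct ℂ S M', inferInstance, inferInstance, β × β', b.tensorProduct b',
      fun i ↦ deg i.1 + deg' i.2, extendRep ω d X' D' F (lam 0), w, hW.extendRep hω _, ?_, ?_, ?_,
      ?_, ?_⟩
    · refine Fin.cases (Fin.cases ?_ fun j ↦ ?_) fun i ↦ Fin.cases ?_ fun j ↦ ?_
      · rw [sub_self]
        exact ((IsHomogeneousOp.one _ _).smul _).sub (IsHomogeneousOp.sum fun a _ ↦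
          (hX a).mul (hD a) (by abel))
      · exact ((hD j).smul _).sub (IsHomogeneousOp.sum fun a _ ↦
          ((hD a).mul (hG a j) (sub_add_sub_cancel _ _ _)).smul _)
      · exact hX i
      · exact hG i j
    · exact tmul_ne_zero b h.vac_ne hv0'
    · exact tmul_mem_gradedPiece h.vac_mem hv' (add_zero 0)
    · refine Fin.cases (Fin.cases (fun h ↦ absurd h (lt_irrefl _)) fun j _ ↦ ?_)
        fun i ↦ Fin.cases (fun h ↦ absurd h (by simp)) fun j hij ↦ ?_
      · change extendRaise _ _ _ _ _ _ _ _ w = 0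
        rw [extendRaise, LinearMap.sub_apply, LinearMap.smul_apply, hDw, smul_zero, zero_sub,
          neg_eq_zero, LinearMap.sum_apply]
        refine Finset.sum_eq_zero fun a _ ↦ ?_
        rw [LinearMap.smul_apply, Module.End.mul_apply, hGw, hDw, smul_zero]
      · change (X' i * D' j + F i j) w = 0
        rw [hGw, hs'.raise i j (Fin.succ_lt_succ_iff.mp hij), TensorProduct.tmul_zero]
    · refine Fin.cases ?_ fun i ↦ ?_
      · change (lam 0 • 1 - ∑ a, X' a * D' a) w = _
        rw [LinearMap.sub_apply, LinearMap.sum_apply, Finset.sum_eq_zero, sub_zero]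
        · rfl
        · intro a _
          rw [Module.End.mul_apply, hDw, map_zero]
      · change (X' i * D' i + F i i) w = _
        rw [hGw, hs'.diag, TensorProduct.tmul_smul]

/-! ### Simple quotients of highest weight modules -/

section Transfer

variable {Γ ι : Type*} [AddCommGroup Γ] [DecidableEq ι] {ω : Γ → Γ → ℂˣ} {d : ι → Γ}

theorem IsMatrixUnitRep.of_injective {M M' : Type*} [AddCommGroup M] [Module ℂ M] [AddCommGroup M']
    [Module ℂ M'] {E : ι → ι → Module.End ℂ M} {E' : ι → ι → Module.End ℂ M'}
    (hE : IsMatrixUnitRep ω d E) (f : M' →ₗ[ℂ] M) (hf : Function.Injective f)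
    (h : ∀ a b u, f (E' a b u) = E a b (f u)) : IsMatrixUnitRep ω d E' := by
  intro i j k l
  ext u
  apply hf
  have := congrArg (fun g : Module.End ℂ M ↦ g (f u)) (hE i j k l)
  split_ifs at this ⊢ <;>
  simpa [h] using this

theorem IsMatrixUnitRep.of_surjective {M M' : Type*} [AddCommGroup M] [Module ℂ M]
    [AddCommGroup M'] [Module ℂ M'] {E : ι → ι → Module.End ℂ M} {E' : ι → ι → Module.End ℂ M'}
    (hE : IsMatrixUnitRep ω d E) (f : M →ₗ[ℂ] M') (hf : Function.Surjective f)
    (h : ∀ a b u, E' a b (f u) = f (E a b u)) : IsMatrixUnitRep ω d E' := by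
  intro i j k l
  ext u
  obtain ⟨u, rfl⟩ := hf u
  have := congrArg (fun g : Module.End ℂ M ↦ f (g u)) (hE i j k l)
  split_ifs at this ⊢ <;>
  simpa [h] using this

end Transfer

section Subquotients

variable {Γ ι : Type*} [AddCommGroup Γ] [DecidableEq Γ] [DecidableEq ι] {ω : Γ → Γ → ℂˣ}
  {d : ι → Γ}

/-- The submodule generated by a homogeneous singular vector is a graded module. -/
theorem exists_cyclic_submodule.{u} [LT ι] {M : Type} [AddCommGroup M] [Module ℂ M]
    {𝓜 : Γ → Submodule ℂ M}
    {E : ι → ι → Module.End ℂ M} (hM : DirectSum.IsInternal 𝓜) (hE : IsMatrixUnitRep ω d E)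
    (hdeg : ∀ a b γ, ∀ u ∈ 𝓜 γ, E a b u ∈ 𝓜 (d a - d b + γ)) {lam : ι → ℂ} {v : M} (hv0 : v ≠ 0)
    {γ : Γ} (hγ : v ∈ 𝓜 γ) (hv : IsSingularVector E lam v) :
    ∃ (M' : Type u) (_ : AddCommGroup M') (_ : Module ℂ M') (𝓜' : Γ → Submodule ℂ M')
      (E' : ι → ι → Module.End ℂ M') (v' : M'), DirectSum.IsInternal 𝓜' ∧
      IsMatrixUnitRep ω d E' ∧ (∀ a b γ, ∀ u ∈ 𝓜' γ, E' a b u ∈ 𝓜' (d a - d b + γ)) ∧ v' ≠ 0 ∧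
      v' ∈ 𝓜' γ ∧ IsSingularVector E' lam v' ∧ IsCyclicVector E' v' := by
  set P : Submodule ℂ M := sInf {W | (∀ i j, ∀ u ∈ W, E i j u ∈ W) ∧ v ∈ W} with hP
  have hvP : v ∈ P := Submodule.mem_sInf.mpr fun W hW ↦ hW.2
  have hst : ∀ i j, ∀ u ∈ P, E i j u ∈ P := fun i j u hu ↦
    Submodule.mem_sInf.mpr fun W hW ↦ hW.1 i j u (Submodule.mem_sInf.mp hu W hW)
  -- The graded core of `P` is itself stable and contains `v`, so minimality of `P` applies.
  have hgr : P ≤ ⨆ δ, P ⊓ 𝓜 δ := by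
    refine sInf_le ⟨fun i j ↦ ?_, Submodule.mem_iSup_of_mem γ ⟨hvP, hγ⟩⟩
    have : ⨆ δ, P ⊓ 𝓜 δ ≤ (⨆ δ, P ⊓ 𝓜 δ).comap (E i j) := iSup_le fun δ u hu ↦
      Submodule.mem_iSup_of_mem (d i - d j + δ) ⟨hst i j u hu.1, hdeg i j δ u hu.2⟩
    exact this
  have hgr' : IsGradedSubspace 𝓜 P := le_antisymm hgr (iSup_le fun δ ↦ inf_le_left)
  obtain ⟨π, h1, h2, h3⟩ := exists_projections hM
  have hπ := (isGradedSubspace_iff hM.submodule_iSup_eq_top h1 h2 h3).mp hgr'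
  -- The model lives in `Type`; lifting moves it to the prescribed universe.
  let g : ULift.{u} P ≃ₗ[ℂ] P := ULift.moduleEquiv
  let f : ULift.{u} P →ₗ[ℂ] M := P.subtype ∘ₗ g.toLinearMap
  have hf : Function.Injective f := P.injective_subtype.comp g.injective
  have hfr : LinearMap.range f = P := by
    rw [LinearMap.range_comp, LinearEquiv.range, Submodule.map_top, Submodule.range_subtype]
  let lift : ∀ T : Module.End ℂ M, (∀ u ∈ P, T u ∈ P) → Module.End ℂ (ULift.{u} P) := fun T hT ↦
    g.symm.toLinearMap ∘ₗ T.restrict hT ∘ₗ g.toLinearMap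
  have hlift : ∀ T hT u, f (lift T hT u) = T (f u) := fun T hT u ↦ by simp [f, lift]
  refine ⟨ULift.{u} P, inferInstance, inferInstance, fun δ ↦ (𝓜 δ).comap f,
    fun i j ↦ lift (E i j) (hst i j), g.symm ⟨v, hvP⟩, ?_, ?_, ?_, ?_, ?_, ?_, ?_⟩
  · refine isInternal_of_projections ?_ (fun δ ↦ lift (π δ) (hπ δ)) ?_ ?_
    · apply Submodule.map_injective_of_injective hf
      rw [Submodule.map_iSup, Submodule.map_top, hfr]
      simp only [Submodule.map_comap_eq, hfr]
      exact hgr'.symm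
    · intro δ u hu
      apply hf
      rw [hlift, h1 δ _ hu]
    · intro δ ε hδε u hu
      apply hf
      rw [hlift, h2 δ ε hδε _ hu, map_zero]
  · exact hE.of_injective f hf fun i j u ↦ hlift _ _ _
  · intro i j δ u hu
    rw [Submodule.mem_comap, hlift]
    exact hdeg i j δ _ hu
  · simpa using hv0
  · simpa [f] using hγ
  · refine ⟨fun i j hij ↦ hf ?_, fun i ↦ hf ?_⟩
    · rw [hlift, map_zero]
      simpa [f] using hv.raise i j hij
    · rw [hlift, map_smul]
      simpa [f] using hv.diag i
  · intro W hW hvW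
    have hPW : P ≤ W.map f := by
      refine sInf_le ⟨?_, ⟨_, hvW, by simp [f]⟩⟩
      rintro i j _ ⟨u, hu, rfl⟩
      exact ⟨_, hW i j u hu, hlift _ _ _⟩
    rw [eq_top_iff]
    rintro u -
    obtain ⟨w, hw, hwu⟩ := hPW (hfr ▸ LinearMap.mem_range_self f u)
    exact hf hwu ▸ hw

/-- A graded module generated by a homogeneous singular vector has a simple graded quotient. -/
theorem exists_simple_quotient [LT ι] {M : Type*} [AddCommGroup M] [Module ℂ M]
    {𝓜 : Γ → Submodule ℂ M}
    {E : ι → ι → Module.End ℂ M} (hM : DirectSum.IsInternal 𝓜) (hE : IsMatrixUnitRep ω d E)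
    (hdeg : ∀ a b γ, ∀ u ∈ 𝓜 γ, E a b u ∈ 𝓜 (d a - d b + γ)) {lam : ι → ℂ} {v : M} (hv0 : v ≠ 0)
    {γ : Γ} (hγ : v ∈ 𝓜 γ) (hv : IsSingularVector E lam v) (hc : IsCyclicVector E v) :
    ∃ (N : Submodule ℂ M) (𝓛 : Γ → Submodule ℂ (M ⧸ N)) (E' : ι → ι → Module.End ℂ (M ⧸ N))
      (v' : M ⧸ N), DirectSum.IsInternal 𝓛 ∧
      IsMatrixUnitRep ω d E' ∧ (∀ a b γ, ∀ u ∈ 𝓛 γ, E' a b u ∈ 𝓛 (d a - d b + γ)) ∧ v' ≠ 0 ∧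
      v' ∈ 𝓛 γ ∧ IsSingularVector E' lam v' ∧ IsCyclicVector E' v' ∧
      ∀ W : Submodule ℂ (M ⧸ N), (∀ i j, ∀ u ∈ W, E' i j u ∈ W) → IsGradedSubspace 𝓛 W →
        W = ⊥ ∨ W = ⊤ := by
  obtain ⟨π, h1, h2, h3⟩ := exists_projections hM
  -- As `v` generates, properness means avoiding `v`, a condition that survives unions of chains. A
  -- maximal member thus gives a graded-simple quotient, without any weight space decomposition.
  let S : Set (Submodule ℂ M) :=
    {N | (∀ i j, ∀ u ∈ N, E i j u ∈ N) ∧ (∀ δ, ∀ u ∈ N, π δ u ∈ N) ∧ v ∉ N}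
  obtain ⟨N, -, hN⟩ := zorn_le_nonempty₀ S (by
    intro c hcS hchain N₀ hN₀
    have hmem : ∀ u, u ∈ sSup c ↔ ∃ N ∈ c, u ∈ N := fun u ↦
      Submodule.mem_sSup_of_directed ⟨N₀, hN₀⟩ hchain.directedOn
    refine ⟨sSup c, ⟨fun i j u hu ↦ ?_, fun δ u hu ↦ ?_, fun hvc ↦ ?_⟩, fun N hN ↦ le_sSup hN⟩
    · obtain ⟨N, hN, hu⟩ := (hmem u).mp hu
      exact (hmem _).mpr ⟨N, hN, (hcS hN).1 i j u hu⟩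
    · obtain ⟨N, hN, hu⟩ := (hmem u).mp hu
      exact (hmem _).mpr ⟨N, hN, (hcS hN).2.1 δ u hu⟩
    · obtain ⟨N, hN, hu⟩ := (hmem v).mp hvc
      exact (hcS hN).2.2 hu) ⊥ (by simp [S, hv0])
  obtain ⟨hst, hgr, hvN⟩ := hN.prop
  let E' : ι → ι → Module.End ℂ (M ⧸ N) := fun i j ↦ N.mapQ N (E i j) (hst i j)
  let π' : Γ → Module.End ℂ (M ⧸ N) := fun δ ↦ N.mapQ N (π δ) (hgr δ)
  have hE' : ∀ i j u, E' i j (N.mkQ u) = N.mkQ (E i j u) := fun i j u ↦ rfl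
  have hπ' : ∀ δ u, π' δ (N.mkQ u) = N.mkQ (π δ u) := fun δ u ↦ rfl
  have hsurj := N.mkQ_surjective
  have htop : ⨆ δ, (𝓜 δ).map N.mkQ = ⊤ := by
    rw [← Submodule.map_iSup, hM.submodule_iSup_eq_top, Submodule.map_top, Submodule.range_mkQ]
  have g1 : ∀ δ, ∀ u ∈ (𝓜 δ).map N.mkQ, π' δ u = u := by
    rintro δ _ ⟨u, hu, rfl⟩
    rw [hπ', h1 δ u hu]
  have g2 : ∀ δ ε, δ ≠ ε → ∀ u ∈ (𝓜 ε).map N.mkQ, π' δ u = 0 := by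
    rintro δ ε hδε _ ⟨u, hu, rfl⟩
    rw [hπ', h2 δ ε hδε u hu, map_zero]
  have g3 : ∀ δ u, π' δ u ∈ (𝓜 δ).map N.mkQ := by
    intro δ u
    obtain ⟨u, rfl⟩ := hsurj u
    exact ⟨_, h3 δ u, rfl⟩
  have hcyc : ∀ W : Submodule ℂ (M ⧸ N), (∀ i j, ∀ u ∈ W, E' i j u ∈ W) → N.mkQ v ∈ W → W = ⊤ := by
    intro W hW hvW
    have := hc (W.comap N.mkQ) (fun i j u hu ↦ hW i j _ hu) hvW
    rw [eq_top_iff]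
    rintro u -
    obtain ⟨u, rfl⟩ := hsurj u
    have hu : u ∈ W.comap N.mkQ := this ▸ Submodule.mem_top
    exact hu
  refine ⟨N, fun δ ↦ (𝓜 δ).map N.mkQ, E', N.mkQ v, isInternal_of_projections htop π' g1 g2,
    hE.of_surjective N.mkQ hsurj hE', ?_, ?_, ⟨v, hγ, rfl⟩, ⟨fun i j hij ↦ ?_, fun i ↦ ?_⟩, hcyc,
    fun W hW hWgr ↦ ?_⟩
  · rintro i j δ _ ⟨u, hu, rfl⟩
    exact ⟨_, hdeg i j δ u hu, rfl⟩
  · rwa [Ne, Submodule.mkQ_apply, Submodule.Quotient.mk_eq_zero]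
  · rw [hE', hv.raise i j hij, map_zero]
  · rw [hE', hv.diag i, map_smul]
  · rw [isGradedSubspace_iff htop g1 g2 g3] at hWgr
    by_cases hvW : N.mkQ v ∈ W
    · exact Or.inr (hcyc W hW hvW)
    · left
      have hle : N ≤ W.comap N.mkQ := fun u hu ↦ by
        rw [Submodule.mem_comap, Submodule.mkQ_apply, (Submodule.Quotient.mk_eq_zero N).mpr hu]
        exact W.zero_mem
      have hmem : W.comap N.mkQ ∈ S := ⟨fun i j u hu ↦ hW i j _ hu, fun δ u hu ↦ hWgr δ _ hu, hvW⟩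
      have hge := hN.le_of_ge hmem hle
      rw [eq_bot_iff]
      intro u hu
      obtain ⟨u, rfl⟩ := hsurj u
      rw [Submodule.mem_bot, Submodule.mkQ_apply, Submodule.Quotient.mk_eq_zero]
      exact hge hu

end Subquotients

/-! ### The theorem for a finite ordered homogeneous basis -/

section Classification

variable {Γ V ι : Type*} [AddCommGroup Γ] [DecidableEq Γ] {ω : Γ → Γ → ℂˣ} [AddCommGroup V]
  [Module ℂ V] {𝒱 : Γ → Submodule ℂ V} [LinearOrder ι] [Fintype ι] {d : ι → Γ}

theorem exists_isHighestWeightModule_of_finiteDimensional (hω : IsCommutativeFactor ω)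
    (hV : DirectSum.IsInternal 𝒱) (e : Module.Basis ι ℂ V) (he : ∀ i, e i ∈ 𝒱 (d i)) {L : Type*}
    [AddCommGroup L] [Module ℂ L] {𝓛 : Γ → Submodule ℂ L}
    {ρ : Module.End ℂ V →ₗ[ℂ] Module.End ℂ L} (h : IsSimpleGlModule ω 𝒱 𝓛 ρ)
    [FiniteDimensional ℂ L] : ∃ lam, IsHighestWeightModule e lam 𝓛 ρ := by
  have := h.nontrivial
  obtain ⟨μ, v, hv0, ⟨γ, hγ⟩, hv⟩ := exists_isSingularVector hω h.isInternal
    (h.toIsGradedGlModule.isMatrixUnitRep hV he)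
    (fun a b γ u hu ↦ h.map_mem _ _ _ (matrixUnit_mem_glDeg hV he a b) u hu)
  refine ⟨∑ i, μ i • eps e i, (isHighestWeightModule_iff e _ 𝓛 ρ).mpr
    ⟨v, hv0, ⟨γ, hγ⟩, ?_, h.isCyclicVector hV he hv0 hγ⟩⟩
  convert hv using 2 with i
  simp [LinearMap.sum_apply, eps_cartanUnit]

theorem finiteDimensional_iff_mem_dominantWeights (hω : IsCommutativeFactor ω)
    (hV : DirectSum.IsInternal 𝒱) (e : Module.Basis ι ℂ V) (he : ∀ i, e i ∈ 𝒱 (d i))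
    (hd : ∀ a b, ω (d a) (d a) = 1 → ω (d b) (d b) = -1 → a < b) {L : Type*}
    [AddCommGroup L] [Module ℂ L] {𝓛 : Γ → Submodule ℂ L}
    {ρ : Module.End ℂ V →ₗ[ℂ] Module.End ℂ L} (h : IsSimpleGlModule ω 𝒱 𝓛 ρ)
    {lam : Module.Dual ℂ (cartan e)} (hlam : IsHighestWeightModule e lam 𝓛 ρ) :
    FiniteDimensional ℂ L ↔ lam ∈ dominantWeights ω e d := by
  have hE : IsMatrixUnitRep ω d fun a b ↦ ρ (matrixUnit e a b) :=
    h.toIsGradedGlModule.isMatrixUnitRep hV he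
  obtain ⟨v, hv0, ⟨γ, hγ⟩, hv, hc⟩ := (isHighestWeightModule_iff e lam 𝓛 ρ).mp hlam
  rw [mem_dominantWeights_iff e hω]
  constructor
  · intro _ a b hab heven
    exact hE.exists_nat_of_finiteDimensional hω hv hv0 hab heven
  · intro hdom
    refine hE.finiteDimensional_of_dominant hω hd hv hv0 hc (fun a b k hk ↦ ?_) hdom
    -- Homogeneity is what lets graded simplicity make these vectors generators.
    have hpow : ∃ δ, (ρ (matrixUnit e b a) ^ k) v ∈ 𝓛 δ := by
      induction k with
      | zero => exact ⟨γ, by simpa using hγ⟩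
      | succ k ih =>
        obtain ⟨δ, hδ⟩ := ih fun h0 ↦ hk (by rw [pow_succ', Module.End.mul_apply, h0, map_zero])
        refine ⟨d b - d a + δ, ?_⟩
        rw [pow_succ', Module.End.mul_apply]
        exact h.map_mem _ _ _ (matrixUnit_mem_glDeg hV he b a) _ hδ
    obtain ⟨δ, hδ⟩ := hpow
    exact h.isCyclicVector hV he hk hδ

theorem exists_isSimpleGlModule.{u} (hω : IsCommutativeFactor ω)
    (hV : DirectSum.IsInternal 𝒱) (e : Module.Basis ι ℂ V) (he : ∀ i, e i ∈ 𝒱 (d i))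
    (lam : Module.Dual ℂ (cartan e)) :
    ∃ (L : Type u) (_ : AddCommGroup L) (_ : Module ℂ L) (𝓛 : Γ → Submodule ℂ L)
      (ρ : Module.End ℂ V →ₗ[ℂ] Module.End ℂ L),
      IsSimpleGlModule ω 𝒱 𝓛 ρ ∧ IsHighestWeightModule e lam 𝓛 ρ := by
  let φ : ι ≃o Fin (Fintype.card ι) := (Fintype.orderIsoFinOfCardEq ι rfl).symm
  obtain ⟨M, _, _, β, b, deg, E, v, hE, hhom, hv0, hvdeg, hv⟩ :=
    exists_graded_singularVector hω (Fintype.card ι) (fun i ↦ d (φ.symm i))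
      fun i ↦ lam (cartanUnit e (φ.symm i))
  have hE' : IsMatrixUnitRep ω d fun i j ↦ E (φ i) (φ j) := by
    intro i j k l
    have := hE (φ i) (φ j) (φ k) (φ l)
    simpa using this
  have hv' : IsSingularVector (fun i j ↦ E (φ i) (φ j)) (fun i ↦ lam (cartanUnit e i)) v :=
    ⟨fun i j hij ↦ hv.raise _ _ (φ.strictMono hij), fun i ↦ by simpa using hv.diag (φ i)⟩
  obtain ⟨P, _, _, 𝓟, EP, vP, hP1, hP2, hP3, hP4, hP5, hP6, hP7⟩ :=
    exists_cyclic_submodule.{_, _, u} (isInternal_gradedPiece b deg) hE'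
      (fun i j γ u hu ↦ by simpa using (hhom (φ i) (φ j)).apply_mem hu) hv0 hvdeg hv'
  obtain ⟨N, 𝓛, EL, vL, h1, h2, h3, h4, h5, h6, h7, h8⟩ :=
    exists_simple_quotient hP1 hP2 hP3 hP4 hP5 hP6 hP7
  have hunits : (fun i j ↦ ofMatrixUnits e EL (matrixUnit e i j)) = EL := by
    funext i j
    exact ofMatrixUnits_matrixUnit EL i j
  refine ⟨P ⧸ N, inferInstance, inferInstance, 𝓛, ofMatrixUnits e EL,
    ⟨isGradedGlModule_ofMatrixUnits hV he h1 h2 h3, ⟨vL, 0, h4⟩, fun W hW hWgr ↦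
      h8 W (fun i j u hu ↦ ?_) hWgr⟩, ?_⟩
  · rw [← ofMatrixUnits_matrixUnit (e := e) EL i j]
    exact hW _ u hu
  · rw [isHighestWeightModule_iff, hunits]
    exact ⟨vL, h4, ⟨0, h5⟩, h6, h7⟩

end Classification

end ColourLie

end

theorem mainTheorem6
    {Γ : Type uG} [AddCommGroup Γ] [DecidableEq Γ]
    (ω : Γ → Γ → ℂˣ) (hω : ColourLie.IsCommutativeFactor ω)
    {V : Type uV} [AddCommGroup V] [Module ℂ V] [FiniteDimensional ℂ V]
    (𝒱 : Γ → Submodule ℂ V) (hV : DirectSum.IsInternal 𝒱)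
    [LinearOrder (ColourLie.GammaR 𝒱)] (hord : ColourLie.IsDistinguished ω 𝒱)
    (B : ∀ α : ColourLie.GammaR 𝒱, Module.Basis (Fin (Module.finrank ℂ (𝒱 α))) ℂ (𝒱 α)) :
    (∀ (L : Type uL) [AddCommGroup L] [Module ℂ L] (𝓛 : Γ → Submodule ℂ L)
        (ρ : Module.End ℂ V →ₗ[ℂ] Module.End ℂ L),
        ColourLie.IsSimpleGlModule ω 𝒱 𝓛 ρ → FiniteDimensional ℂ L →
        ∃ lam : Module.Dual ℂ (ColourLie.cartan (ColourLie.homogeneousBasis hV B)),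
          ColourLie.IsHighestWeightModule (ColourLie.homogeneousBasis hV B) lam 𝓛 ρ) ∧
    (∀ lam : Module.Dual ℂ (ColourLie.cartan (ColourLie.homogeneousBasis hV B)),
      (∃ (L : Type uV) (_ : AddCommGroup L) (_ : Module ℂ L) (𝓛 : Γ → Submodule ℂ L)
        (ρ : Module.End ℂ V →ₗ[ℂ] Module.End ℂ L),
        ColourLie.IsSimpleGlModule ω 𝒱 𝓛 ρ ∧
        ColourLie.IsHighestWeightModule (ColourLie.homogeneousBasis hV B) lam 𝓛 ρ) ∧
      ∀ (L : Type uL) [AddCommGroup L] [Module ℂ L] (𝓛 : Γ → Submodule ℂ L)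
        (ρ : Module.End ℂ V →ₗ[ℂ] Module.End ℂ L),
        ColourLie.IsSimpleGlModule ω 𝒱 𝓛 ρ →
        ColourLie.IsHighestWeightModule (ColourLie.homogeneousBasis hV B) lam 𝓛 ρ →
        (FiniteDimensional ℂ L ↔
          lam ∈ ColourLie.dominantWeights ω (ColourLie.homogeneousBasis hV B)
            ColourLie.BasisIndex.deg)) := by
  let : Fintype (ColourLie.BasisIndex 𝒱) :=
    FiniteDimensional.fintypeBasisIndex (ColourLie.homogeneousBasis hV B)
  have he : ∀ i, ColourLie.homogeneousBasis hV B i ∈ 𝒱 i.deg := fun i ↦ by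
    rw [ColourLie.homogeneousBasis_apply]
    exact (B (ofLex i).1 (ofLex i).2).2
  -- The first lexicographic component already decides, by the distinguished order on degrees.
  have hd : ∀ a b : ColourLie.BasisIndex 𝒱, ω a.deg a.deg = 1 → ω b.deg b.deg = -1 → a < b :=
    fun a b ha hb ↦ Sigma.Lex.left _ _ (hord _ _ ha hb)
  refine ⟨fun L _ _ 𝓛 ρ h _ ↦
    ColourLie.exists_isHighestWeightModule_of_finiteDimensional hω hV _ he h, fun lam ↦
    ⟨ColourLie.exists_isSimpleGlModule hω hV _ he lam, fun L _ _ 𝓛 ρ h hlam ↦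
      ColourLie.finiteDimensional_iff_mem_dominantWeights hω hV _ he hd h hlam⟩⟩
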